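/- Let $\lambda\in(0,\infty)$ and $\theta\in\mathbb R$. For a graph $G$ on $n$ vertices let $E(G)$ be its number of edges and $V_T(G)$ the number of its vertices that lie in a triangle. Let $\mathbb P$ be the law of the Erdős–Rényi random graph on $n$ vertices with edge probability $p_n=\lambda/n$ (replaced by $1$ for the finitely many $n<\lambda$), and let $\mathbb P_\beta$ be the exponential random graph measure $$\frac{d\mathbb P_\beta}{d\mathbb P}(G)=\frac{1}{Z_n(\beta)}\,e^{\beta \log n\, V_T(G)},\qquad \beta=\beta_n=\frac13+\frac{\theta}{\log n},$$ where $Z_n(\beta)$ is the normalizing constant. For $a\in[0,1]$, $x\in\mathbb R$ and $\ell>0$ put $$\Lambda(a,x,\ell)=xa-(1-a)\log(1-a)-\tfrac a3\log\tfrac a3-\tfrac23a-\tfrac13a\log 6+a\log\ell$$ (with $0\log 0=0$). **Theorem (consistent estimation).** Let $G_n$ be distributed according to $\mathbb P_{\beta_n}$ and define $$\hat\lambda_n=\frac{2E(G_n)}{n}-\frac{2V_T(G_n)}{n},\qquad \hat\Theta_n=\Big\{x\in\mathbb R:\ \hat\lambda_n>0 \text{ and } \operatorname*{arg\,max}_{0\le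 a\le 1}\Lambda(a,x,\hat\lambda_n)=\{V_T(G_n)/n\}\Big\},$$ where $\operatorname{arg\,max}$ denotes the set of all maximizers. Then, as $n\to\infty$: 1. $\hat\lambda_n\to\lambda$ in $\mathbb P_{\beta_n}$-probability; 2. $\mathbb P_{\beta_n}(\hat\Theta_n\text{ has exactly one element})\to1$; 3. $\hat\theta_n\to\theta$ in $\mathbb P_{\beta_n}$-probability for every estimator $\hat\theta_n$, a function of $G_n$, with $\hat\theta_n\in\hat\Theta_n$ whenever $\hat\Theta_n\neq\emptyset$. -/

import Mathlib

open MeasureTheory Filter Topology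

noncomputable section

namespace TriangleERGM

/-- `E(G)`: the number of edges of a graph on the vertex set `{0, …, n-1}`. -/
def numEdges {n : ℕ} (G : SimpleGraph (Fin n)) : ℕ :=
  G.edgeSet.ncard

/-- `V_T(G)`: the number of vertices that are part of a triangle of `G`. -/
def numTriangleVertices {n : ℕ} (G : SimpleGraph (Fin n)) : ℕ :=
  {v : Fin n | ∃ u w : Fin n, G.Adj v u ∧ G.Adj u w ∧ G.Adj w v}.ncard

/-- The edge probability `p_n = λ / n`, as an element of `[0, 1]`. The value is cut off at `1` when
`λ / n > 1`, which for fixed `λ > 0` only concerns the finitely many `n < λ`. -/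
def edgeProb (lam : ℝ) (n : ℕ) : unitInterval :=
  Set.projIcc (0 : ℝ) 1 zero_le_one (lam / n)

/-- The law of the Erdős–Rényi (binomial) random graph on `n` vertices with edge probability
`λ / n`. -/
def erdosRenyi (lam : ℝ) (n : ℕ) : Measure (SimpleGraph (Fin n)) :=
  SimpleGraph.binomialRandom (Fin n) (edgeProb lam n)

/-- The exponential random graph measure `ℙ_β` on graphs with `n` vertices:
`dℙ_β / dℙ = exp (β * log n * V_T) / Z_n(β)`, where `ℙ` is the Erdős–Rényi law with edge probability
`λ / n` and `Z_n(β)` is the normalizing constant. -/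
def ergm (lam β : ℝ) (n : ℕ) : Measure (SimpleGraph (Fin n)) :=
  (erdosRenyi lam n).tilted fun G => β * Real.log n * numTriangleVertices G

/-- The exponential random graph measure in the critical window, `β = 1/3 + θ / log n`. -/
def criticalErgm (lam θ : ℝ) (n : ℕ) : Measure (SimpleGraph (Fin n)) :=
  ergm lam (1 / 3 + θ / Real.log n) n

/-- `Λ(a, θ, λ)`, for `a ∈ [0, 1]`, `θ ∈ ℝ` and `λ > 0`. `Real.log 0 = 0` gives the usual
convention `0 log 0 = 0`. -/
def Lam (a θ lam : ℝ) : ℝ :=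
  θ * a - (1 - a) * Real.log (1 - a) - (a / 3) * Real.log (a / 3)
    - (2 / 3) * a - (1 / 3) * a * Real.log 6 + a * Real.log lam

/-- The set of all maximizers of `a ↦ Λ(a, θ, λ)` over `[0, 1]`. -/
def argmaxLam (θ lam : ℝ) : Set ℝ :=
  {a | a ∈ Set.Icc (0 : ℝ) 1 ∧ IsMaxOn (fun b => Lam b θ lam) (Set.Icc (0 : ℝ) 1) a}

/-- `λ̂_n = 2 E(G) / n - 2 V_T(G) / n`. -/
def lamHat {n : ℕ} (G : SimpleGraph (Fin n)) : ℝ :=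
  2 * (numEdges G : ℝ) / n - 2 * (numTriangleVertices G : ℝ) / n

/-- The set of all `x` such that `argmax_{0 ≤ a ≤ 1} Λ(a, x, λ̂_n)` is `V_T(G) / n`, that is, such
that `V_T(G) / n` is the one and only maximizer. As `Λ` is only defined for positive values of its
last argument, the set is empty if `λ̂_n ≤ 0`. -/
def thetaHatSet {n : ℕ} (G : SimpleGraph (Fin n)) : Set ℝ :=
  {x | 0 < lamHat G ∧ argmaxLam x (lamHat G) = {(numTriangleVertices G : ℝ) / n}}

/-- Convergence in probability, under the laws `P n`, of `X n` to the constant `c`. -/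
def TendstoInProb (P : ∀ n : ℕ, Measure (SimpleGraph (Fin n)))
    (X : ∀ n : ℕ, SimpleGraph (Fin n) → ℝ) (c : ℝ) : Prop :=
  ∀ ε : ℝ, 0 < ε → Tendsto (fun n => P n {G | ε ≤ |X n G - c|}) atTop (𝓝 0)

instance measurableSingletonClass_graph (n : ℕ) :
    MeasurableSingletonClass (SimpleGraph (Fin n)) where
  measurableSet_singleton G := by
    have h : ({G} : Set (SimpleGraph (Fin n))) =
        SimpleGraph.edgeSet ⁻¹' {G.edgeSet} := by
      ext H
      simp
    rw [h]
    exact SimpleGraph.measurable_edgeSet (measurableSet_singleton _)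

/-- The exponential random graph measure is a probability measure. -/
instance isProbabilityMeasure_ergm (lam β : ℝ) (n : ℕ) :
    IsProbabilityMeasure (ergm lam β n) := by
  unfold ergm erdosRenyi
  exact isProbabilityMeasure_tilted (Integrable.of_finite)

end TriangleERGM

end

/-!
The proof computes the free energy of the model and reads off the law of large numbers from its
convexity. Encode a graph by its set of edges and let `Y_n(x, w)` (`partitionSum`) be the sum over
all graphs on `n` vertices of `x ^ E * w ^ V_T`. With `x` the edge odds `p / (1 - p)` and
`w = n ^ (1/3) e ^ θ`, the measure `ℙ_β` gives a graph the probability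
`x ^ E * w ^ V_T / Y_n(x, w)`, so that exponential moments of `E` and `V_T` are ratios of values of
`Y_n`, at parameters of the same form (`criticalErgm_le`).

The asymptotics (`tendsto_log_partitionSum`) are `log Y_n / n → λ / 2 + max_a Λ(a, θ, λ)` whenever
`n x → λ`. The first term comes from the edges outside of triangles and the second one from
families of vertex-disjoint triangles: the families of `k` triangles have total weight
`exp (n Λ(3k/n, θ, λ))` up to polynomial factors (`abs_log_card_packings_sub_le`).

* Upper bound (`partitionSum_le`). In every graph the triangle vertices are covered by a maximal
  family of disjoint triangles, then by a maximal family of triangles that each bring two new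
  vertices, and then by triangles that each bring one new vertex `v` and rest on an edge `e` between
  vertices covered before (`exists_decomposition`). A union bound over these data applies. A triangle
  of the second kind has weight `x ^ 3 * w ^ 2` and there are at most `n ^ 3` choices, in total
  `O(n ^ (2/3))`. For the third kind the sum factorizes over the base edges `e`, and `e` either
  belongs to one of the `O(n)` edges used before or costs a factor `x`, in total `O(n ^ (1/3))`. All
  of this is `exp (o(n))`.
* Lower bound (`le_partitionSum`). Planting `k` disjoint triangles in a random graph creates a bounded
  expected number of further triangles, so that with probability at least `1 / 2` the graph contains
  only polynomially many families of `k` disjoint triangles.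

The maximizer `a` of `Λ(·, θ, λ)` is unique, lies in `(0, 1)` and determines `θ` through
`θ = log (2a) / 3 - log (1 - a) - log λ` (`dualParam`, `argmaxLam_eq_singleton_iff`); this follows from
Gibbs' inequality without differentiating. The exponential Markov inequality gives `V_T / n → a`. Since
`Λ` depends on `θ` and `λ` only through `θ + log λ`, tilting by `e ^ (s (E - V_T))` changes the free
energy by exactly `λ (e ^ s - 1) / 2`, which gives `(E - V_T) / n → λ / 2`, that is, `λ̂_n → λ`. Finally,
when `λ̂_n > 0` and `0 < V_T < n`, the set `Θ̂_n` is the singleton of `dualParam (V_T / n) λ̂_n`, and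
`dualParam` is continuous.
-/

namespace TriangleERGM

/-! ### The variational problem -/

/-- The value of `θ` for which `a ∈ (0, 1)` is the maximizer of `Λ(·, θ, ℓ)`, found by solving
`∂_a Λ(a, θ, ℓ) = 0` for `θ`. -/
noncomputable def dualParam (a ℓ : ℝ) : ℝ :=
  Real.log (2 * a) / 3 - Real.log (1 - a) - Real.log ℓ

/-- The maximum of `Λ(·, θ, ℓ)` in terms of the maximizer `a`, for `θ = dualParam a ℓ`; it does not
depend on `ℓ`. -/
noncomputable def maxVal (a : ℝ) : ℝ :=
  -Real.log (1 - a) - 2 / 3 * a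

theorem Lam_add (a θ τ ℓ : ℝ) : Lam a (θ + τ) ℓ = Lam a θ ℓ + τ * a := by
  unfold Lam; ring

theorem Lam_dualParam {a₀ : ℝ} (h0 : 0 < a₀) (a ℓ : ℝ) :
    Lam a (dualParam a₀ ℓ) ℓ = a / 3 * (Real.log a₀ - Real.log a)
      + (1 - a) * (Real.log (1 - a₀) - Real.log (1 - a)) - Real.log (1 - a₀) - 2 / 3 * a := by
  have h6 : Real.log 6 = Real.log 2 + Real.log 3 := by
    rw [← Real.log_mul (by norm_num) (by norm_num)]; norm_num
  have h2a : Real.log (2 * a₀) = Real.log 2 + Real.log a₀ :=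
    Real.log_mul (by norm_num) h0.ne'
  unfold Lam dualParam
  rw [h2a, h6]
  by_cases ha : a = 0
  · subst ha; simp
  · rw [Real.log_div ha (by norm_num)]; ring

theorem Lam_dualParam_self {a₀ : ℝ} (h0 : 0 < a₀) (ℓ : ℝ) :
    Lam a₀ (dualParam a₀ ℓ) ℓ = maxVal a₀ := by
  rw [Lam_dualParam h0, maxVal]; ring

theorem mul_log_sub_log_lt {y y₀ : ℝ} (hy : 0 ≤ y) (h0 : 0 < y₀) (hne : y ≠ y₀) :
    y * (Real.log y₀ - Real.log y) < y₀ - y := by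
  rcases hy.eq_or_lt with rfl | hy
  · simpa using h0
  · rw [← Real.log_div h0.ne' hy.ne']
    have h := Real.log_lt_sub_one_of_pos (div_pos h0 hy)
      (fun h => hne ((div_eq_one_iff_eq hy.ne').1 h).symm)
    calc y * Real.log (y₀ / y) < y * (y₀ / y - 1) := mul_lt_mul_of_pos_left h hy
      _ = y₀ - y := by field_simp

/-- The critical point of `Λ` is its strict global maximizer: this is Gibbs' inequality. -/
theorem Lam_lt_maxVal {a₀ : ℝ} (h0 : 0 < a₀) (h1 : a₀ < 1) {a : ℝ} (ha : a ∈ Set.Icc (0 : ℝ) 1)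
    (hne : a ≠ a₀) (ℓ : ℝ) : Lam a (dualParam a₀ ℓ) ℓ < maxVal a₀ := by
  rw [Lam_dualParam h0, maxVal]
  have e1 := mul_log_sub_log_lt ha.1 h0 hne
  have e2 := mul_log_sub_log_lt (y := 1 - a) (y₀ := 1 - a₀) (by linarith [ha.2]) (by linarith)
    (by intro h; apply hne; linarith)
  linarith

theorem Lam_le_maxVal {a₀ : ℝ} (h0 : 0 < a₀) (h1 : a₀ < 1) {a : ℝ} (ha : a ∈ Set.Icc (0 : ℝ) 1)
    (ℓ : ℝ) : Lam a (dualParam a₀ ℓ) ℓ ≤ maxVal a₀ := by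
  rcases eq_or_ne a a₀ with rfl | hne
  · exact (Lam_dualParam_self h0 ℓ).le
  · exact (Lam_lt_maxVal h0 h1 ha hne ℓ).le

theorem argmaxLam_dualParam {a₀ : ℝ} (h0 : 0 < a₀) (h1 : a₀ < 1) (ℓ : ℝ) :
    argmaxLam (dualParam a₀ ℓ) ℓ = {a₀} := by
  ext a
  simp only [argmaxLam, Set.mem_ofPred_eq, Set.mem_singleton_iff]
  constructor
  · rintro ⟨ha, hmax⟩
    by_contra hne
    have := hmax (show a₀ ∈ Set.Icc (0 : ℝ) 1 from ⟨h0.le, h1.le⟩)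
    simp only [Set.mem_ofPred_eq, Lam_dualParam_self h0] at this
    exact absurd (Lam_lt_maxVal h0 h1 ha hne ℓ) (not_lt.2 this)
  · rintro rfl
    refine ⟨⟨h0.le, h1.le⟩, fun b hb => ?_⟩
    simp only [Set.mem_ofPred_eq, Lam_dualParam_self h0]
    exact Lam_le_maxVal h0 h1 hb ℓ

/-- Every `θ` is the dual parameter of some density in `(0, 1)`: a root of the cubic
`2 a = (ℓ e^θ (1 - a))³`. -/
theorem exists_dualParam_eq (θ : ℝ) {ℓ : ℝ} (hℓ : 0 < ℓ) :
    ∃ a, 0 < a ∧ a < 1 ∧ dualParam a ℓ = θ := by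
  set c := ℓ * Real.exp θ with hc
  have hc0 : 0 < c := by positivity
  have hcont : ContinuousOn (fun a : ℝ => 2 * a - (c * (1 - a)) ^ 3) (Set.Icc 0 1) := by fun_prop
  obtain ⟨a, ha, hroot⟩ := intermediate_value_Icc (zero_le_one' ℝ) hcont
    (show (0 : ℝ) ∈ _ by constructor <;> simp; positivity)
  simp only at hroot
  have ha0 : 0 < a := by
    rcases ha.1.eq_or_lt with rfl | h
    · simp at hroot; exact absurd hroot hc0.ne'
    · exact h
  have ha1 : a < 1 := by
    rcases ha.2.eq_or_lt with rfl | h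
    · norm_num at hroot
    · exact h
  refine ⟨a, ha0, ha1, ?_⟩
  have h2 : 2 * a = (c * (1 - a)) ^ 3 := by linarith
  have h1a : 0 < 1 - a := by linarith
  rw [dualParam, h2, Real.log_pow, Real.log_mul hc0.ne' h1a.ne', hc,
    Real.log_mul hℓ.ne' (Real.exp_pos _).ne', Real.log_exp]
  push_cast; ring

theorem dualParam_lt_dualParam {a b : ℝ} (ha : 0 < a) (hab : a < b) (hb : b < 1) (ℓ : ℝ) :
    dualParam a ℓ < dualParam b ℓ := by
  unfold dualParam
  have e1 : Real.log (2 * a) < Real.log (2 * b) := Real.log_lt_log (by linarith) (by linarith)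
  have e2 : Real.log (1 - b) < Real.log (1 - a) := Real.log_lt_log (by linarith) (by linarith)
  linarith

theorem argmaxLam_eq_singleton_iff {ℓ : ℝ} (hℓ : 0 < ℓ) (x a : ℝ) :
    argmaxLam x ℓ = {a} ↔ 0 < a ∧ a < 1 ∧ x = dualParam a ℓ := by
  constructor
  · intro h
    obtain ⟨b, hb0, hb1, rfl⟩ := exists_dualParam_eq x hℓ
    rw [argmaxLam_dualParam hb0 hb1, Set.singleton_eq_singleton_iff] at h
    subst h
    exact ⟨hb0, hb1, rfl⟩
  · rintro ⟨h0, h1, rfl⟩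
    exact argmaxLam_dualParam h0 h1 ℓ

theorem continuousAt_dualParam {a ℓ : ℝ} (h0 : 0 < a) (h1 : a < 1) (hℓ : 0 < ℓ) :
    ContinuousAt (fun q : ℝ × ℝ => dualParam q.1 q.2) (a, ℓ) := by
  have e1 : 2 * a ≠ 0 := by positivity
  have e2 : 1 - a ≠ 0 := by linarith
  have e3 : ℓ ≠ 0 := hℓ.ne'
  unfold dualParam
  refine ContinuousAt.sub (ContinuousAt.sub (ContinuousAt.div_const ?_ _) ?_) ?_
  · exact ContinuousAt.log (by fun_prop) e1
  · exact ContinuousAt.log (by fun_prop) e2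
  · exact ContinuousAt.log (by fun_prop) e3

theorem continuousAt_Lam {a : ℝ} (h0 : 0 < a) (h1 : a < 1) (θ ℓ : ℝ) :
    ContinuousAt (fun b => Lam b θ ℓ) a := by
  have e1 : a / 3 ≠ 0 := by positivity
  have e2 : 1 - a ≠ 0 := by linarith
  unfold Lam
  have c1 : ContinuousAt (fun b : ℝ => Real.log (b / 3)) a := ContinuousAt.log (by fun_prop) e1
  have c2 : ContinuousAt (fun b : ℝ => Real.log (1 - b)) a := ContinuousAt.log (by fun_prop) e2
  fun_prop

/-! ### Logarithms of factorials -/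

theorem le_log_factorial (m : ℕ) : (m : ℝ) * Real.log m - m ≤ Real.log (m.factorial) := by
  rcases Nat.eq_zero_or_pos m with rfl | hm
  · simp
  · have hm' : (0 : ℝ) < m := by exact_mod_cast hm
    have h := Real.pow_div_factorial_le_exp (m : ℝ) hm'.le m
    have hf : (0 : ℝ) < m.factorial := by exact_mod_cast m.factorial_pos
    have := Real.log_le_log (by positivity) h
    rw [Real.log_exp, Real.log_div (by positivity) hf.ne', Real.log_pow] at this
    linarith

theorem log_factorial_le (m : ℕ) :
    Real.log (m.factorial) ≤ m * Real.log m - m + 1 + Real.log (m + 1) := by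
  have key : ∀ m : ℕ, Real.log ((m + 1).factorial) ≤
      (m + 1 : ℝ) * Real.log (m + 1) - (m + 1) + 1 + Real.log (m + 1) := by
    intro m
    induction m with
    | zero => simp
    | succ m ih =>
      have hp : (0 : ℝ) < m + 1 := by positivity
      have hp2 : (0 : ℝ) < m + 1 + 1 := by positivity
      rw [Nat.factorial_succ, Nat.cast_mul, Real.log_mul (by positivity)
        (by exact_mod_cast (m + 1).factorial_ne_zero)]
      have h1 := Real.log_le_sub_one_of_pos (div_pos hp hp2)
      rw [Real.log_div hp.ne' hp2.ne'] at h1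
      have h2 : ((m : ℝ) + 1 + 1) * (Real.log (m + 1) - Real.log (m + 1 + 1)) ≤ -1 := by
        calc _ ≤ ((m : ℝ) + 1 + 1) * ((m + 1) / (m + 1 + 1) - 1) :=
              mul_le_mul_of_nonneg_left h1 hp2.le
          _ = -1 := by field_simp; ring
      push_cast at ih ⊢
      nlinarith
  rcases m with _ | m
  · simp
  · have h := key m
    have h2 : Real.log ((m : ℝ) + 1) ≤ Real.log ((m : ℝ) + 1 + 1) :=
      Real.log_le_log (by positivity) (by linarith)
    push_cast
    linarith

/-! ### Counting families of disjoint triples -/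

section Packings

variable {V : Type*}

open Classical in
/-- The families of `k` pairwise disjoint `3`-element subsets of `W`. -/
noncomputable def packings (W : Finset V) (k : ℕ) : Finset (Finset (Finset V)) :=
  {T ∈ (W.powersetCard 3).powersetCard k | (T : Set (Finset V)).PairwiseDisjoint id}

theorem mem_packings {W : Finset V} {k : ℕ} {T : Finset (Finset V)} :
    T ∈ packings W k ↔ (∀ t ∈ T, t ⊆ W ∧ t.card = 3) ∧ T.card = k ∧
      (T : Set (Finset V)).PairwiseDisjoint id := by
  simp only [packings, Finset.mem_filter, Finset.mem_powersetCard,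
    Finset.subset_iff (s₁ := T), and_assoc]

variable [DecidableEq V]

theorem card_biUnion_of_mem_packings {W : Finset V} {k : ℕ} {T : Finset (Finset V)}
    (hT : T ∈ packings W k) : (T.biUnion id).card = 3 * k := by
  obtain ⟨h1, h2, h3⟩ := mem_packings.1 hT
  have hsum : ∑ t ∈ T, (id t).card = T.card * 3 := Finset.sum_const_nat fun t ht => (h1 t ht).2
  rw [Finset.card_biUnion h3, hsum, h2, mul_comm]

theorem biUnion_subset_of_mem_packings {W : Finset V} {k : ℕ} {T : Finset (Finset V)}
    (hT : T ∈ packings W k) : T.biUnion id ⊆ W :=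
  Finset.biUnion_subset.2 fun t ht => ((mem_packings.1 hT).1 t ht).1

/-- Double counting of the pairs (family of `k + 1` triples, one of its triples). -/
theorem card_packings_succ (W : Finset V) (k : ℕ) :
    (k + 1) * (packings W (k + 1)).card = (packings W k).card * (W.card - 3 * k).choose 3 := by
  have hL : ((packings W (k + 1)).sigma fun T => T).card = (k + 1) * (packings W (k + 1)).card := by
    rw [Finset.card_sigma, Finset.sum_congr rfl (fun T hT => (mem_packings.1 hT).2.1),
      Finset.sum_const, smul_eq_mul, mul_comm]
  have hR : ((packings W k).sigma fun T => (W \ T.biUnion id).powersetCard 3).card =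
      (packings W k).card * (W.card - 3 * k).choose 3 := by
    rw [Finset.card_sigma, Finset.sum_congr rfl (g := fun _ => (W.card - 3 * k).choose 3),
      Finset.sum_const, smul_eq_mul]
    intro T hT
    rw [Finset.card_powersetCard, Finset.card_sdiff_of_subset (biUnion_subset_of_mem_packings hT),
      card_biUnion_of_mem_packings hT]
  rw [← hL, ← hR]
  refine Finset.card_nbij' (fun q => ⟨q.1.erase q.2, q.2⟩) (fun q => ⟨insert q.2 q.1, q.2⟩)
    ?_ ?_ ?_ ?_
  · rintro ⟨T, t⟩ h
    simp only [Finset.coe_sigma, Set.mem_sigma_iff, Finset.mem_coe] at h ⊢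
    obtain ⟨hT, ht⟩ := h
    obtain ⟨h1, h2, h3⟩ := mem_packings.1 hT
    refine ⟨mem_packings.2 ⟨fun s hs => h1 s (Finset.mem_of_mem_erase hs), ?_, ?_⟩, ?_⟩
    · rw [Finset.card_erase_of_mem ht, h2]; rfl
    · exact h3.subset (by simp)
    · rw [Finset.mem_powersetCard, Finset.subset_sdiff, Finset.disjoint_biUnion_right]
      refine ⟨⟨(h1 t ht).1, fun s hs => ?_⟩, (h1 t ht).2⟩
      exact h3 ht (Finset.mem_of_mem_erase hs) (Finset.ne_of_mem_erase hs).symm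
  · rintro ⟨T, t⟩ h
    simp only [Finset.coe_sigma, Set.mem_sigma_iff, Finset.mem_coe] at h ⊢
    obtain ⟨hT, ht⟩ := h
    obtain ⟨h1, h2, h3⟩ := mem_packings.1 hT
    rw [Finset.mem_powersetCard, Finset.subset_sdiff, Finset.disjoint_biUnion_right] at ht
    obtain ⟨⟨ht1, ht2⟩, ht3⟩ := ht
    have hnot : t ∉ T := fun hmem => by
      have := ht2 t hmem
      rw [id, disjoint_self, Finset.bot_eq_empty] at this
      simp [this] at ht3
    refine ⟨mem_packings.2 ⟨?_, ?_, ?_⟩, Finset.mem_insert_self _ _⟩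
    · intro s hs
      rcases Finset.mem_insert.1 hs with rfl | hs
      · exact ⟨ht1, ht3⟩
      · exact h1 s hs
    · rw [Finset.card_insert_of_notMem hnot, h2]
    · rw [Finset.coe_insert]
      exact h3.insert fun s hs _ => ht2 s hs
  · rintro ⟨T, t⟩ h
    simp only [Finset.coe_sigma, Set.mem_sigma_iff, Finset.mem_coe] at h
    simp [Finset.insert_erase h.2]
  · rintro ⟨T, t⟩ h
    simp only [Finset.coe_sigma, Set.mem_sigma_iff, Finset.mem_coe] at h
    obtain ⟨hT, ht⟩ := h
    rw [Finset.mem_powersetCard, Finset.subset_sdiff, Finset.disjoint_biUnion_right] at ht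
    have hnot : t ∉ T := fun hmem => by
      have := ht.1.2 t hmem
      rw [id, disjoint_self, Finset.bot_eq_empty] at this
      simp [this] at ht
    simp [Finset.erase_insert hnot]

theorem card_packings_mul (W : Finset V) {k : ℕ} (hk : 3 * k ≤ W.card) :
    (packings W k).card * (6 ^ k * k.factorial * (W.card - 3 * k).factorial) =
      W.card.factorial := by
  induction k with
  | zero =>
    have : packings W 0 = {∅} := by
      ext T
      simp only [mem_packings, Finset.card_eq_zero, Finset.mem_singleton]
      constructor
      · exact fun h => h.2.1
      · rintro rfl; simp
    simp [this]
  | succ k ih =>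
    have hrec := card_packings_succ W k
    have hch := Nat.choose_mul_factorial_mul_factorial (n := W.card - 3 * k) (k := 3) (by omega)
    have h3 : W.card - 3 * k - 3 = W.card - 3 * (k + 1) := by omega
    rw [h3, show Nat.factorial 3 = 6 from rfl] at hch
    rw [← ih (by omega), ← hch, Nat.factorial_succ, pow_succ]
    calc _ = ((k + 1) * (packings W (k + 1)).card) *
          (6 ^ k * 6 * k.factorial * (W.card - 3 * (k + 1)).factorial) := by ring
      _ = _ := by rw [hrec]; ring

theorem card_packings_pos (W : Finset V) {k : ℕ} (hk : 3 * k ≤ W.card) :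
    0 < (packings W k).card := by
  refine Nat.pos_of_ne_zero fun h => W.card.factorial_ne_zero ?_
  rw [← card_packings_mul W hk, h, zero_mul]

/-- The weighted number of families of `k` disjoint triples is `exp (n Λ(3k/n, θ, ℓ))` up to
factors that are polynomial in the number `n` of vertices; each vertex of a triple carries the weight
`ℓ e^θ n^(-2/3)`. -/
theorem abs_log_card_packings_sub_le (W : Finset V) {k : ℕ} (hk : 3 * k ≤ W.card)
    (hW : 0 < W.card) (θ : ℝ) {ℓ : ℝ} :
    |Real.log (packings W k).card
        + 3 * k * (Real.log ℓ + θ - 2 / 3 * Real.log W.card)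
      - W.card * Lam (3 * k / W.card) θ ℓ| ≤ 2 * (1 + Real.log (W.card + 1)) := by
  set n := W.card with hn
  have hn0 : (0 : ℝ) < n := by exact_mod_cast hW
  have hkn : (3 * k : ℝ) ≤ n := by exact_mod_cast hk
  have hcast : ((n - 3 * k : ℕ) : ℝ) = n - 3 * k := by
    rw [Nat.cast_sub hk]; push_cast; ring
  have hlog : Real.log (packings W k).card + k * Real.log 6 + Real.log k.factorial
      + Real.log (n - 3 * k).factorial = Real.log n.factorial := by
    have h := card_packings_mul W hk
    have hc : ((packings W k).card : ℝ) ≠ 0 := by exact_mod_cast (card_packings_pos W hk).ne'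
    have hf1 : (k.factorial : ℝ) ≠ 0 := by exact_mod_cast k.factorial_ne_zero
    have hf2 : ((n - 3 * k).factorial : ℝ) ≠ 0 := by exact_mod_cast (n - 3 * k).factorial_ne_zero
    rw [← hn] at h
    rw [← h]
    push_cast
    rw [Real.log_mul hc (by positivity), Real.log_mul (by positivity) hf2,
      Real.log_mul (by positivity) hf1, Real.log_pow]
    ring
  have e1 := le_log_factorial n
  have e2 := log_factorial_le n
  have e3 := le_log_factorial k
  have e4 := log_factorial_le k
  have e5 := le_log_factorial (n - 3 * k)
  have e6 := log_factorial_le (n - 3 * k)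
  rw [hcast] at e5 e6
  have l1 : Real.log ((k : ℝ) + 1) ≤ Real.log (n + 1) :=
    Real.log_le_log (by positivity) (by have : (0 : ℝ) ≤ k := by positivity
                                        linarith)
  have l2 : Real.log ((n : ℝ) - 3 * k + 1) ≤ Real.log (n + 1) :=
    Real.log_le_log (by linarith) (by have : (0 : ℝ) ≤ k := by positivity
                                      linarith)
  have l3 : 0 ≤ Real.log ((n : ℝ) + 1) := Real.log_nonneg (by linarith)
  -- the exact form of `n Λ(3k/n)`, in which the terms with `log n` cancel
  have hΛ : n * Lam (3 * k / n) θ ℓ = (n * Real.log n - n) -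
      ((n - 3 * k) * Real.log (n - 3 * k) - (n - 3 * k)) - (k * Real.log k - k) - k * Real.log 6
      + 3 * k * (Real.log ℓ + θ - 2 / 3 * Real.log n) := by
    have a1 : (1 - 3 * (k : ℝ) / n) = (n - 3 * k) / n := by field_simp
    have a2 : 3 * (k : ℝ) / n / 3 = k / n := by field_simp
    have b1 : (n - 3 * k : ℝ) * Real.log ((n - 3 * k) / n) =
        (n - 3 * k) * (Real.log (n - 3 * k) - Real.log n) := by
      rcases hkn.eq_or_lt with h | h
      · rw [h]; simp
      · rw [Real.log_div (by linarith) hn0.ne']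
    have b2 : (k : ℝ) * Real.log (k / n) = k * (Real.log k - Real.log n) := by
      rcases Nat.eq_zero_or_pos k with rfl | h
      · simp
      · rw [Real.log_div (by positivity) hn0.ne']
    unfold Lam
    rw [a1, a2]
    have : (n : ℝ) * (θ * (3 * k / n) - (n - 3 * k) / n * Real.log ((n - 3 * k) / n) -
        k / n * Real.log (k / n) - 2 / 3 * (3 * k / n) - 1 / 3 * (3 * k / n) * Real.log 6
        + 3 * k / n * Real.log ℓ) =
        3 * k * θ - (n - 3 * k) * Real.log ((n - 3 * k) / n) - k * Real.log (k / n)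
        - 2 * k - k * Real.log 6 + 3 * k * Real.log ℓ := by
      field_simp
    rw [this, b1, b2]
    ring
  rw [hΛ, abs_le]
  constructor <;> linarith

end Packings

/-! ### Graphs as sets of pairs, and their weighted sums -/

section Sums

/-- Sums over the supersets of `S` inside `E`, weighted by `x` per element. -/
theorem sum_filter_superset {ι : Type*} [DecidableEq ι] {E S : Finset ι} (hS : S ⊆ E) (x : ℝ)
    (F : Finset ι → ℝ) :
    ∑ A ∈ E.powerset with S ⊆ A, x ^ A.card * F A =
      x ^ S.card * ∑ B ∈ (E \ S).powerset, x ^ B.card * F (S ∪ B) := by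
  rw [Finset.mul_sum]
  refine Finset.sum_nbij' (fun A => A \ S) (fun B => S ∪ B) ?_ ?_ ?_ ?_ ?_
  · intro A hA
    simp only [Finset.mem_filter, Finset.mem_powerset] at hA ⊢
    exact Finset.sdiff_subset_sdiff hA.1 le_rfl
  · intro B hB
    simp only [Finset.mem_filter, Finset.mem_powerset] at hB ⊢
    exact ⟨Finset.union_subset hS (hB.trans Finset.sdiff_subset), Finset.subset_union_left⟩
  · intro A hA
    simp only [Finset.mem_filter] at hA
    exact Finset.union_sdiff_of_subset hA.2
  · intro B hB
    simp only [Finset.mem_powerset, Finset.subset_sdiff] at hB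
    exact Finset.union_sdiff_cancel_left hB.2.symm
  · intro A hA
    simp only [Finset.mem_filter] at hA
    rw [Finset.union_sdiff_of_subset hA.2, ← mul_assoc, ← pow_add, add_comm,
      Finset.card_sdiff_add_card_eq_card hA.2]

theorem sum_powerset_pow_card {ι : Type*} (E : Finset ι) (x : ℝ) :
    ∑ B ∈ E.powerset, x ^ B.card = (1 + x) ^ E.card := by
  have h := Finset.sum_pow_mul_eq_add_pow x 1 E
  simpa [add_comm] using h

theorem sum_filter_superset_pow_card {ι : Type*} [DecidableEq ι] {E S : Finset ι} (hS : S ⊆ E)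
    (x : ℝ) : ∑ A ∈ E.powerset with S ⊆ A, x ^ A.card =
      x ^ S.card * (1 + x) ^ (E.card - S.card) := by
  have h := sum_filter_superset hS x (fun _ => 1)
  simp only [mul_one] at h
  rw [h, sum_powerset_pow_card, Finset.card_sdiff_of_subset hS]

theorem disjoint_powersetCard_two {V : Type*} {s t : Finset V} (h : Disjoint s t) :
    Disjoint (s.powersetCard 2) (t.powersetCard 2) := by
  rw [Finset.disjoint_left]
  intro f hf hf'
  rw [Finset.mem_powersetCard] at hf hf'
  have : f = ∅ := Finset.bot_eq_empty ▸ disjoint_self.1 (h.mono hf.1 hf'.1)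
  simp [this] at hf

end Sums

section Graphs

variable (V : Type*) [Fintype V]

/-- The possible edges of a graph on `V`, as `2`-element sets. A graph is encoded by its set
`A ⊆ pairs V` of edges. -/
def pairs : Finset (Finset V) :=
  Finset.univ.powersetCard 2

variable {V}

@[simp] theorem mem_pairs {e : Finset V} : e ∈ pairs V ↔ e.card = 2 := by
  simp [pairs]

variable [DecidableEq V]

/-- The triangles of the graph with edge set `A`, as `3`-element sets of vertices. -/
def triangles (A : Finset (Finset V)) : Finset (Finset V) :=
  {t ∈ Finset.univ.powersetCard 3 | t.powersetCard 2 ⊆ A}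

theorem mem_triangles {A : Finset (Finset V)} {t : Finset V} :
    t ∈ triangles A ↔ t.card = 3 ∧ t.powersetCard 2 ⊆ A := by
  simp [triangles]

/-- The vertices that lie in a triangle of the graph with edge set `A`. -/
def triangleVerts (A : Finset (Finset V)) : Finset V :=
  (triangles A).biUnion id

theorem subset_triangleVerts {A : Finset (Finset V)} {t : Finset V} (ht : t ∈ triangles A) :
    t ⊆ triangleVerts A :=
  Finset.subset_biUnion_of_mem id ht

variable (V)

/-- The sum over all graphs on `V` of `x` to the number of edges times `w` to the number of
triangle vertices: the partition function of the exponential random graph, for edge odds `x`. -/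
def partitionSum (x w : ℝ) : ℝ :=
  ∑ A ∈ (pairs V).powerset, x ^ A.card * w ^ (triangleVerts A).card

variable {V}

end Graphs

/-! ### Decomposing the triangle vertices of a graph -/

section Core

variable {V : Type*} [DecidableEq V]

theorem exists_maximal_disjoint {ι : Type*} [DecidableEq ι] (s : Finset ι) (f : ι → Finset V)
    (hf : ∀ i ∈ s, (f i).Nonempty) :
    ∃ T ⊆ s, (T : Set ι).PairwiseDisjoint f ∧ ∀ i ∈ s, ¬ Disjoint (f i) (T.biUnion f) := by
  classical
  obtain ⟨T, hT, hmax⟩ := Finset.exists_max_image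
    (s.powerset.filter fun T : Finset ι => (T : Set ι).PairwiseDisjoint f) Finset.card ⟨∅, by simp⟩
  simp only [Finset.mem_filter, Finset.mem_powerset, and_imp] at hT hmax
  refine ⟨T, hT.1, hT.2, fun i hi hdisj => ?_⟩
  rw [Finset.disjoint_biUnion_right] at hdisj
  have hiT : i ∉ T := fun h => (hf i hi).ne_empty (by simpa using hdisj i h)
  have := hmax (insert i T) (Finset.insert_subset hi hT.1) (by
    rw [Finset.coe_insert]
    exact hT.2.insert fun j hj _ => hdisj j hj)
  rw [Finset.card_insert_of_notMem hiT] at this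
  omega

/-- The edges of a family `T` of triangles and of the triangles `{u, a, b}`, `(u, {a, b}) ∈ C`. -/
def coreEdges (T : Finset (Finset V)) (C : Finset (V × Finset V)) : Finset (Finset V) :=
  T.biUnion (Finset.powersetCard 2) ∪ C.biUnion fun c => (insert c.1 c.2).powersetCard 2

/-- `T` is a family of disjoint triangles, and `C` a family of further triangles `{u, a, b}` with
exactly the vertex `u` in common with `T`, for disjoint pairs `{a, b}`. -/
structure IsCore (T : Finset (Finset V)) (C : Finset (V × Finset V)) : Prop where
  card_eq_three : ∀ t ∈ T, t.card = 3
  disjoint : (T : Set (Finset V)).PairwiseDisjoint id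
  fst_mem : ∀ c ∈ C, c.1 ∈ T.biUnion id
  card_snd : ∀ c ∈ C, c.2.card = 2
  disjoint_snd_core : ∀ c ∈ C, Disjoint c.2 (T.biUnion id)
  disjoint_snd : (C : Set (V × Finset V)).PairwiseDisjoint Prod.snd

namespace IsCore

variable {T : Finset (Finset V)} {C : Finset (V × Finset V)}

theorem exists_mem_snd {c : V × Finset V} {f : Finset V} (hf : f ∈ (insert c.1 c.2).powersetCard 2) :
    ∃ y ∈ f, y ∈ c.2 := by
  rw [Finset.mem_powersetCard] at hf
  obtain ⟨y, hy, hne⟩ := Finset.exists_mem_ne (by omega : 1 < f.card) c.1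
  exact ⟨y, hy, (Finset.mem_insert.1 (hf.1 hy)).resolve_left hne⟩

theorem card_insert (h : IsCore T C) {c : V × Finset V} (hc : c ∈ C) :
    (insert c.1 c.2).card = 3 := by
  rw [Finset.card_insert_of_notMem, h.card_snd c hc]
  exact fun hmem => Finset.disjoint_left.1 (h.disjoint_snd_core c hc) hmem (h.fst_mem c hc)

theorem card_coreEdges (h : IsCore T C) : (coreEdges T C).card = 3 * T.card + 3 * C.card := by
  have h1 : (T.biUnion (Finset.powersetCard 2)).card = 3 * T.card := by
    rw [Finset.card_biUnion, Finset.sum_const_nat (m := 3), mul_comm]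
    · intro t ht
      rw [Finset.card_powersetCard, h.card_eq_three t ht]; rfl
    · exact fun t ht t' ht' hne => disjoint_powersetCard_two (h.disjoint ht ht' hne)
  have h2 : (C.biUnion fun c => (insert c.1 c.2).powersetCard 2).card = 3 * C.card := by
    rw [Finset.card_biUnion, Finset.sum_const_nat (m := 3), mul_comm]
    · intro c hc
      rw [Finset.card_powersetCard, h.card_insert hc]; rfl
    · intro c hc c' hc' hne
      rw [Function.onFun, Finset.disjoint_left]
      intro f hf hf'
      obtain ⟨y, hy, hyc⟩ := exists_mem_snd hf
      rcases Finset.mem_insert.1 ((Finset.mem_powersetCard.1 hf').1 hy) with rfl | hy'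
      · exact Finset.disjoint_left.1 (h.disjoint_snd_core c hc) hyc (h.fst_mem c' hc')
      · exact Finset.disjoint_left.1 (h.disjoint_snd hc hc' hne) hyc hy'
  rw [coreEdges, Finset.card_union_of_disjoint, h1, h2]
  rw [Finset.disjoint_left]
  intro f hf hf'
  simp only [Finset.mem_biUnion] at hf hf'
  obtain ⟨t, ht, hft⟩ := hf
  obtain ⟨c, hc, hfc⟩ := hf'
  obtain ⟨y, hy, hyc⟩ := exists_mem_snd hfc
  exact Finset.disjoint_left.1 (h.disjoint_snd_core c hc) hyc
    (Finset.mem_biUnion.2 ⟨t, ht, (Finset.mem_powersetCard.1 hft).1 hy⟩)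

theorem subset_of_mem_coreEdges (h : IsCore T C) {f : Finset V} (hf : f ∈ coreEdges T C) :
    f ⊆ T.biUnion id ∪ C.biUnion Prod.snd := by
  intro y hy
  simp only [coreEdges, Finset.mem_union, Finset.mem_biUnion] at hf
  rcases hf with ⟨t, ht, hft⟩ | ⟨c, hc, hfc⟩
  · exact Finset.mem_union_left _
      (Finset.mem_biUnion.2 ⟨t, ht, (Finset.mem_powersetCard.1 hft).1 hy⟩)
  · rcases Finset.mem_insert.1 ((Finset.mem_powersetCard.1 hfc).1 hy) with rfl | hy'
    · exact Finset.mem_union_left _ (h.fst_mem c hc)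
    · exact Finset.mem_union_right _ (Finset.mem_biUnion.2 ⟨c, hc, hy'⟩)

end IsCore

end Core

section Decomposition

variable {V : Type*} [Fintype V] [DecidableEq V]

/-- The edges joining the vertices in `D e` to both ends of `e`. -/
def legEdges (D : pairs V → Finset V) : Finset (Finset V) :=
  Finset.univ.biUnion fun e => (D e).biUnion fun v => e.1.image fun u => {v, u}

/-- The pairs `e` that are the base of some triangle `e ∪ {v}`, `v ∈ D e`. -/
def baseEdges (D : pairs V → Finset V) : Finset (Finset V) :=
  (Finset.univ.filter fun e => (D e).Nonempty).image Subtype.val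

namespace IsCore

variable {T : Finset (Finset V)} {C : Finset (V × Finset V)}

theorem mem_packings (h : IsCore T C) : T ∈ packings Finset.univ T.card :=
  TriangleERGM.mem_packings.2
    ⟨fun t ht => ⟨Finset.subset_univ t, h.card_eq_three t ht⟩, rfl, h.disjoint⟩

theorem card_verts (h : IsCore T C) :
    (T.biUnion id ∪ C.biUnion Prod.snd).card = 3 * T.card + 2 * C.card := by
  rw [Finset.card_union_of_disjoint, card_biUnion_of_mem_packings h.mem_packings,
    Finset.card_biUnion h.disjoint_snd, Finset.sum_const_nat (m := 2) h.card_snd]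
  · ring
  · rw [Finset.disjoint_biUnion_right]
    exact fun c hc => (h.disjoint_snd_core c hc).symm

theorem card_coreEdges_le (h : IsCore T C) : (coreEdges T C).card ≤ 2 * Fintype.card V := by
  have h1 := h.card_verts
  have h2 := Finset.card_le_univ (T.biUnion id ∪ C.biUnion Prod.snd)
  rw [h.card_coreEdges]
  omega

end IsCore

theorem card_legEdges {D : pairs V → Finset V} {W : Finset V} (hW : ∀ e, ∀ v ∈ D e, v ∉ W)
    (he : ∀ e, (D e).Nonempty → e.1 ⊆ W) (hD : ∀ e e' v, v ∈ D e → v ∈ D e' → e = e') :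
    (legEdges D).card = 2 * ∑ e, (D e).card := by
  -- each leg has exactly one end outside `W`, so that it determines `v` and then `e`
  have key : ∀ e v e' v', v ∈ D e → v' ∈ D e' → ∀ f ∈ e.1.image (fun u => ({v, u} : Finset V)),
      f ∈ e'.1.image (fun u => ({v', u} : Finset V)) → v = v' := by
    intro e v e' v' hv hv' f hf hf'
    simp only [Finset.mem_image] at hf hf'
    obtain ⟨u, hu, rfl⟩ := hf
    obtain ⟨u', hu', heq⟩ := hf'
    have hv2 : v ∈ ({v', u'} : Finset V) := by rw [heq]; simp
    rcases Finset.mem_insert.1 hv2 with h | h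
    · exact h
    · rw [Finset.mem_singleton] at h
      subst h
      exact absurd (he e' ⟨v', hv'⟩ hu') (hW e _ hv)
  rw [legEdges, Finset.card_biUnion, Finset.mul_sum]
  · refine Finset.sum_congr rfl fun e _ => ?_
    rw [Finset.card_biUnion, Finset.sum_const_nat (m := 2), mul_comm]
    · intro v hv
      rw [Finset.card_image_of_injOn, mem_pairs.1 e.2]
      intro u hu u' hu' heq
      have hne : u ≠ v := fun h => hW e v hv (he e ⟨v, hv⟩ (h ▸ hu))
      have : u ∈ ({v, u'} : Finset V) := by
        have h2 : ({v, u} : Finset V) = {v, u'} := heq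
        rw [← h2]; simp
      simpa [hne] using this
    · intro v hv v' hv' hne
      rw [Function.onFun, Finset.disjoint_left]
      exact fun f hf hf' => hne (key e v e v' hv hv' f hf hf')
  · intro e _ e' _ hne
    rw [Function.onFun, Finset.disjoint_left]
    intro f hf hf'
    simp only [Finset.mem_biUnion] at hf hf'
    obtain ⟨v, hv, hf⟩ := hf
    obtain ⟨v', hv', hf'⟩ := hf'
    have := key e v e' v' hv hv' f hf hf'
    subst this
    exact hne (hD e e' v hv hv')

theorem card_union_legEdges {T : Finset (Finset V)} {C : Finset (V × Finset V)} (h : IsCore T C)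
    {D : pairs V → Finset V} (hW : ∀ e, ∀ v ∈ D e, v ∉ T.biUnion id ∪ C.biUnion Prod.snd)
    (he : ∀ e, (D e).Nonempty → e.1 ⊆ T.biUnion id ∪ C.biUnion Prod.snd)
    (hD : ∀ e e' v, v ∈ D e → v ∈ D e' → e = e') :
    (coreEdges T C ∪ baseEdges D ∪ legEdges D).card =
      3 * T.card + 3 * C.card + (baseEdges D \ coreEdges T C).card + 2 * ∑ e, (D e).card := by
  rw [Finset.card_union_of_disjoint, card_legEdges hW he hD, ← Finset.union_sdiff_self_eq_union,
    Finset.card_union_of_disjoint Finset.disjoint_sdiff, h.card_coreEdges]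
  rw [Finset.disjoint_left]
  intro f hf hf'
  simp only [legEdges, Finset.mem_biUnion, Finset.mem_image] at hf'
  obtain ⟨e, -, v, hv, u, hu, rfl⟩ := hf'
  refine hW e v hv ?_
  rcases Finset.mem_union.1 hf with hf | hf
  · exact h.subset_of_mem_coreEdges hf (by simp)
  · simp only [baseEdges, Finset.mem_image, Finset.mem_filter] at hf
    obtain ⟨e', ⟨-, hne⟩, heq⟩ := hf
    exact he e' hne (heq ▸ by simp)

/-- The triangle vertices of a graph: a maximal family `T` of disjoint triangles, a maximal family
`C` of triangles that each add two new vertices to `T`, and, for each remaining vertex `v`, a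
triangle formed by `v` and an edge `e` on the vertices covered before (so that `v ∈ D e`). -/
theorem exists_decomposition (A : Finset (Finset V)) :
    ∃ (T : Finset (Finset V)) (C : Finset (V × Finset V)) (D : pairs V → Finset V),
      T ∈ packings Finset.univ T.card ∧ C ⊆ Finset.univ ×ˢ pairs V ∧
      (coreEdges T C).card ≤ 2 * Fintype.card V ∧
      (triangleVerts A).card = 3 * T.card + 2 * C.card + ∑ e, (D e).card ∧
      coreEdges T C ∪ baseEdges D ∪ legEdges D ⊆ A ∧
      (coreEdges T C ∪ baseEdges D ∪ legEdges D).card =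
        3 * T.card + 3 * C.card + (baseEdges D \ coreEdges T C).card + 2 * ∑ e, (D e).card := by
  classical
  obtain ⟨T, hTA, hTd, hTmax⟩ := exists_maximal_disjoint (triangles A) id (by
    intro t ht
    rw [← Finset.card_pos, id, (mem_triangles.1 ht).1]; norm_num)
  set U := T.biUnion id with hU
  obtain ⟨C, hCs, hCd, hCmax⟩ := exists_maximal_disjoint
    ((Finset.univ ×ˢ pairs V).filter fun c : V × Finset V =>
      c.1 ∈ U ∧ Disjoint c.2 U ∧ insert c.1 c.2 ∈ triangles A) Prod.snd (by
    intro c hc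
    simp only [Finset.mem_filter, Finset.mem_product, mem_pairs] at hc
    rw [← Finset.card_pos, hc.1.2]; norm_num)
  have hC : ∀ c ∈ C, c.2.card = 2 ∧ c.1 ∈ U ∧ Disjoint c.2 U ∧
      insert c.1 c.2 ∈ triangles A := fun c hc => by
    simpa using hCs hc
  have hcore : IsCore T C := ⟨fun t ht => (mem_triangles.1 (hTA ht)).1, hTd,
    fun c hc => (hC c hc).2.1, fun c hc => (hC c hc).1, fun c hc => (hC c hc).2.2.1, hCd⟩
  set M := C.biUnion Prod.snd with hM
  have hbase : ∀ v ∈ triangleVerts A \ (U ∪ M), ∃ e : Finset V, e ∈ pairs V ∧ e ⊆ U ∪ M ∧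
      insert v e ∈ triangles A := by
    intro v hv
    obtain ⟨hv1, hv2⟩ := Finset.mem_sdiff.1 hv
    obtain ⟨t, ht, hvt⟩ := Finset.mem_biUnion.1 hv1
    rw [id] at hvt
    have ht3 := (mem_triangles.1 ht).1
    refine ⟨t.erase v, mem_pairs.2 (by rw [Finset.card_erase_of_mem hvt, ht3]), ?_,
      by simpa only [Finset.insert_erase hvt] using ht⟩
    intro y hy
    simp only [Finset.mem_erase] at hy
    by_contra hyUM
    obtain ⟨u, hut, huU⟩ := Finset.not_disjoint_iff.1 (hTmax t ht)
    rw [id] at hut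
    have huv : u ≠ v := fun h => hv2 (Finset.mem_union_left _ (h ▸ huU))
    have huy : u ≠ y := fun h => hyUM (Finset.mem_union_left _ (h ▸ huU))
    have heq : ({v, y} : Finset V) = t.erase u := by
      refine Finset.eq_of_subset_of_card_le ?_ ?_
      · intro z hz
        rcases Finset.mem_insert.1 hz with rfl | hz
        · exact Finset.mem_erase.2 ⟨huv.symm, hvt⟩
        · rw [Finset.mem_singleton.1 hz]
          exact Finset.mem_erase.2 ⟨huy.symm, hy.2⟩
      · rw [Finset.card_erase_of_mem hut, ht3, Finset.card_pair hy.1.symm]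
    have hnd := hCmax (u, t.erase u) (by
      simp only [Finset.mem_filter, Finset.mem_product, Finset.mem_univ, mem_pairs, true_and]
      refine ⟨by rw [Finset.card_erase_of_mem hut, ht3], huU, ?_, by
        rwa [Finset.insert_erase hut]⟩
      rw [← heq]
      simp only [Finset.disjoint_insert_left, Finset.disjoint_singleton_left]
      exact ⟨fun h => hv2 (Finset.mem_union_left _ h),
        fun h => hyUM (Finset.mem_union_left _ h)⟩)
    apply hnd
    simp only [← heq, Finset.disjoint_insert_left, Finset.disjoint_singleton_left]
    exact ⟨fun h => hv2 (Finset.mem_union_right _ h),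
      fun h => hyUM (Finset.mem_union_right _ h)⟩
  set B := triangleVerts A \ (U ∪ M) with hB
  choose! g hg using hbase
  let D : pairs V → Finset V := fun e => B.filter fun v => g v = e.1
  have hDmem : ∀ e v, v ∈ D e ↔ v ∈ B ∧ g v = e.1 := fun e v => Finset.mem_filter
  have hDcard : ∑ e, (D e).card = B.card := by
    rw [Finset.card_eq_sum_card_fiberwise (f := g) (t := pairs V) fun v hv => (hg v hv).1]
    exact Finset.sum_coe_sort (pairs V) fun e => (B.filter fun v => g v = e).card
  have hUM : U ∪ M ⊆ triangleVerts A := by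
    refine Finset.union_subset (Finset.biUnion_subset.2 fun t ht => subset_triangleVerts (hTA ht))
      (Finset.biUnion_subset.2 fun c hc => ?_)
    exact (Finset.subset_insert _ _).trans (subset_triangleVerts (hC c hc).2.2.2)
  have hW : ∀ e, ∀ v ∈ D e, v ∉ U ∪ M := fun e v hv =>
    (Finset.mem_sdiff.1 ((hDmem e v).1 hv).1).2
  have he : ∀ e, (D e).Nonempty → e.1 ⊆ U ∪ M := by
    rintro e ⟨v, hv⟩
    obtain ⟨hvB, heq⟩ := (hDmem e v).1 hv
    exact heq ▸ (hg v hvB).2.1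
  refine ⟨T, C, D, hcore.mem_packings, ?_, hcore.card_coreEdges_le, ?_, ?_, ?_⟩
  · exact hCs.trans (Finset.filter_subset _ _)
  · have hv := hcore.card_verts
    rw [← hU, ← hM] at hv
    rw [hDcard, ← hv, hB, Finset.card_sdiff_of_subset hUM]
    have := Finset.card_le_card hUM
    omega
  · refine Finset.union_subset (Finset.union_subset (Finset.union_subset ?_ ?_) ?_) ?_
    · exact Finset.biUnion_subset.2 fun t ht => (mem_triangles.1 (hTA ht)).2
    · exact Finset.biUnion_subset.2 fun c hc => (mem_triangles.1 (hC c hc).2.2.2).2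
    · intro f hf
      simp only [baseEdges, Finset.mem_image, Finset.mem_filter] at hf
      obtain ⟨e, ⟨-, v, hv⟩, rfl⟩ := hf
      obtain ⟨hvB, heq⟩ := (hDmem e v).1 hv
      exact (mem_triangles.1 (hg v hvB).2.2).2
        (Finset.mem_powersetCard.2 ⟨heq ▸ Finset.subset_insert _ _, mem_pairs.1 e.2⟩)
    · intro f hf
      simp only [legEdges, Finset.mem_biUnion, Finset.mem_image] at hf
      obtain ⟨e, -, v, hv, u, hu, rfl⟩ := hf
      have hvu : v ≠ u := fun h => hW e v hv (he e ⟨v, hv⟩ (h ▸ hu))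
      obtain ⟨hvB, heq⟩ := (hDmem e v).1 hv
      refine (mem_triangles.1 (hg v hvB).2.2).2
        (Finset.mem_powersetCard.2 ⟨?_, Finset.card_pair hvu⟩)
      exact Finset.insert_subset_insert _ (Finset.singleton_subset_iff.2 (heq ▸ hu))
  · refine card_union_legEdges hcore hW he fun e e' v hv hv' => ?_
    exact Subtype.ext (((hDmem e v).1 hv).2.symm.trans ((hDmem e' v).1 hv').2)

end Decomposition

section Bounds

variable {V : Type*} [Fintype V] [DecidableEq V]

/-! ### The upper bound for the partition function -/

omit [DecidableEq V] in
theorem sum_ite_nonempty_mul_pow_card (x y : ℝ) :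
    ∑ s : Finset V, (if s.Nonempty then x else 1) * y ^ s.card =
      1 + x * ((1 + y) ^ Fintype.card V - 1) := by
  classical
  have h : ∀ s : Finset V, (if s.Nonempty then x else 1) * y ^ s.card =
      x * y ^ s.card + if s = ∅ then 1 - x else 0 := by
    intro s
    rcases s.eq_empty_or_nonempty with rfl | hs
    · simp
    · simp [hs, hs.ne_empty]
  have h2 := sum_powerset_pow_card (Finset.univ : Finset V) y
  rw [Finset.powerset_univ, Finset.card_univ] at h2
  rw [Finset.sum_congr rfl fun s _ => h s, Finset.sum_add_distrib, ← Finset.mul_sum, h2,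
    Finset.sum_ite_eq' Finset.univ ∅]
  simp only [Finset.mem_univ, if_true]
  ring

/-- The sum over all families `D` factorizes over the base edges `e`; a base edge outside of `H`
has to be paid for with a factor `x`, but only when `D e` is nonempty. -/
theorem sum_attachments_le {x y : ℝ} (hx : 0 ≤ x) (hy : 0 ≤ y) (H : Finset (Finset V)) :
    ∑ D : pairs V → Finset V, x ^ (baseEdges D \ H).card * y ^ ∑ e, (D e).card ≤
      ((1 + y) ^ Fintype.card V) ^ H.card *
        (1 + x * ((1 + y) ^ Fintype.card V - 1)) ^ (pairs V).card := by
  set β := (1 + y) ^ Fintype.card V with hβ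
  have hβ1 : 1 ≤ β := one_le_pow₀ (by linarith)
  set δ := 1 + x * (β - 1) with hδ
  have hδ1 : 1 ≤ δ := by
    have := mul_nonneg hx (sub_nonneg.2 hβ1)
    linarith
  let γ : pairs V → Finset V → ℝ := fun e s =>
    (if s.Nonempty then (if e.1 ∈ H then 1 else x) else 1) * y ^ s.card
  have hterm : ∀ D : pairs V → Finset V,
      x ^ (baseEdges D \ H).card * y ^ ∑ e, (D e).card = ∏ e, γ e (D e) := by
    intro D
    have hcard : (baseEdges D \ H).card =
        (Finset.univ.filter fun e : pairs V => (D e).Nonempty ∧ e.1 ∉ H).card := by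
      rw [← Finset.card_image_of_injective _ Subtype.val_injective]
      congr 1
      ext f
      simp only [baseEdges, Finset.mem_sdiff, Finset.mem_image, Finset.mem_filter,
        Finset.mem_univ, true_and]
      constructor
      · rintro ⟨⟨e, he, rfl⟩, h⟩
        exact ⟨e, ⟨he, h⟩, rfl⟩
      · rintro ⟨e, ⟨he, h⟩, rfl⟩
        exact ⟨⟨e, he, rfl⟩, h⟩
    rw [Finset.prod_mul_distrib, Finset.prod_pow_eq_pow_sum, hcard, ← Finset.prod_const,
      Finset.prod_filter]
    congr 1
    refine Finset.prod_congr rfl fun e _ => ?_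
    by_cases h1 : (D e).Nonempty <;> by_cases h2 : e.1 ∈ H <;> simp [h1, h2]
  have hsum : ∀ e : pairs V, ∑ s : Finset V, γ e s = if e.1 ∈ H then β else δ := by
    intro e
    by_cases h : e.1 ∈ H
    · have := sum_ite_nonempty_mul_pow_card (V := V) 1 y
      simp only [γ, h, if_true]
      rw [this, ← hβ]; ring
    · simp only [γ, h, if_false]
      exact sum_ite_nonempty_mul_pow_card x y
  have hprod : ∑ D : pairs V → Finset V, ∏ e, γ e (D e) = ∏ e, ∑ s : Finset V, γ e s := by
    rw [Finset.prod_univ_sum, Fintype.piFinset_univ]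
  rw [Finset.sum_congr rfl fun D _ => hterm D, hprod, Finset.prod_congr rfl fun e _ => hsum e,
    Finset.prod_ite, Finset.prod_const, Finset.prod_const]
  refine mul_le_mul (pow_le_pow_right₀ hβ1 ?_) (pow_le_pow_right₀ hδ1 ?_) (by positivity)
    (by positivity)
  · rw [← Finset.card_image_of_injective _ Subtype.val_injective]
    refine Finset.card_le_card fun f hf => ?_
    simp only [Finset.mem_image, Finset.mem_filter] at hf
    obtain ⟨e, ⟨-, he⟩, rfl⟩ := hf
    exact he
  · exact (Finset.card_filter_le _ _).trans (by simp)

/-- The union bound over all decompositions of the set of triangle vertices. The second factor is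
the sum over families of disjoint triangles; in the relevant scaling the last three factors are
`exp (o (n))`. -/
theorem partitionSum_le {x w : ℝ} (hx0 : 0 ≤ x) (hw : 0 ≤ w) :
    partitionSum V x w ≤ (1 + x) ^ (pairs V).card *
      ((∑ k ∈ Finset.range (Fintype.card V + 1),
        ((packings (Finset.univ : Finset V) k).card : ℝ) * (x * w) ^ (3 * k)) *
      ((1 + x ^ 3 * w ^ 2) ^ (Fintype.card V * (pairs V).card) *
      (((1 + w * x ^ 2) ^ Fintype.card V) ^ (2 * Fintype.card V) *
        (1 + x * ((1 + w * x ^ 2) ^ Fintype.card V - 1)) ^ (pairs V).card))) := by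
  classical
  set n := Fintype.card V with hn
  set K := ((1 + w * x ^ 2) ^ n) ^ (2 * n) * (1 + x * ((1 + w * x ^ 2) ^ n - 1)) ^ (pairs V).card
    with hK
  have hβ1 : 1 ≤ (1 + w * x ^ 2) ^ n := one_le_pow₀ (by nlinarith [mul_nonneg hw (sq_nonneg x)])
  have hK0 : 0 ≤ K := by
    have := mul_nonneg hx0 (sub_nonneg.2 hβ1)
    positivity
  let TT : Finset (Finset (Finset V)) := (Finset.range (n + 1)).biUnion (packings Finset.univ)
  let CC : Finset (Finset (V × Finset V)) := (Finset.univ ×ˢ pairs V).powerset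
  let S : Finset (Finset V) × Finset (V × Finset V) × (pairs V → Finset V) → Finset (Finset V) :=
    fun q => coreEdges q.1 q.2.1 ∪ baseEdges q.2.2 ∪ legEdges q.2.2
  let W : Finset (Finset V) × Finset (V × Finset V) × (pairs V → Finset V) → ℝ :=
    fun q => w ^ (3 * q.1.card + 2 * q.2.1.card + ∑ e, (q.2.2 e).card)
  let Q := (TT ×ˢ CC ×ˢ (Finset.univ : Finset (pairs V → Finset V))).filter fun q =>
    (coreEdges q.1 q.2.1).card ≤ 2 * n ∧ S q ⊆ pairs V ∧
    (S q).card = 3 * q.1.card + 3 * q.2.1.card + (baseEdges q.2.2 \ coreEdges q.1 q.2.1).card +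
      2 * ∑ e, (q.2.2 e).card
  have hW0 : ∀ q, 0 ≤ W q := fun q => pow_nonneg hw _
  have hdecomp : ∀ A ∈ (pairs V).powerset, w ^ (triangleVerts A).card ≤
      ∑ q ∈ Q, if S q ⊆ A then W q else 0 := by
    intro A hA
    obtain ⟨T, C, D, hT, hC, hcore, hcard, hSA, hS⟩ := exists_decomposition A
    have hq : (T, C, D) ∈ Q := by
      simp only [Q, TT, CC, Finset.mem_filter, Finset.mem_product, Finset.mem_biUnion,
        Finset.mem_powerset, Finset.mem_univ, and_true, Finset.mem_range]
      refine ⟨⟨⟨T.card, ?_, hT⟩, hC⟩, hcore, hSA.trans (Finset.mem_powerset.1 hA), hS⟩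
      have h1 := card_biUnion_of_mem_packings hT
      have h2 := Finset.card_le_univ (T.biUnion id)
      omega
    refine le_trans (le_of_eq ?_) (Finset.single_le_sum
      (f := fun q => if S q ⊆ A then W q else 0) (fun q _ => ?_) hq)
    · simp only [S, W, hSA, if_true, hcard]
    · split_ifs
      · exact hW0 q
      · exact le_rfl
  have hstep1 : partitionSum V x w ≤ ∑ q ∈ Q, W q *
      ∑ A ∈ (pairs V).powerset with S q ⊆ A, x ^ A.card := by
    calc partitionSum V x w
        ≤ ∑ A ∈ (pairs V).powerset, x ^ A.card * ∑ q ∈ Q, if S q ⊆ A then W q else 0 :=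
          Finset.sum_le_sum fun A hA =>
            mul_le_mul_of_nonneg_left (hdecomp A hA) (pow_nonneg hx0 _)
      _ = _ := by
          simp_rw [Finset.mul_sum]
          rw [Finset.sum_comm]
          refine Finset.sum_congr rfl fun q _ => ?_
          rw [Finset.sum_filter]
          refine Finset.sum_congr rfl fun A _ => ?_
          split_ifs <;> ring
  have hstep2 : ∀ q ∈ Q, W q * ∑ A ∈ (pairs V).powerset with S q ⊆ A, x ^ A.card ≤
      (1 + x) ^ (pairs V).card * ((x * w) ^ (3 * q.1.card) * ((x ^ 3 * w ^ 2) ^ q.2.1.card *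
        (x ^ (baseEdges q.2.2 \ coreEdges q.1 q.2.1).card *
          (w * x ^ 2) ^ ∑ e, (q.2.2 e).card))) := by
    intro q hq
    obtain ⟨-, -, hS, hcard⟩ := Finset.mem_filter.1 hq
    rw [sum_filter_superset_pow_card hS, hcard]
    have h1 : (1 + x) ^ ((pairs V).card - (S q).card) ≤ (1 + x) ^ (pairs V).card :=
      pow_le_pow_right₀ (by linarith) (Nat.sub_le _ _)
    rw [hcard] at h1
    calc _ ≤ W q * (x ^ (3 * q.1.card + 3 * q.2.1.card +
          (baseEdges q.2.2 \ coreEdges q.1 q.2.1).card + 2 * ∑ e, (q.2.2 e).card) *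
          (1 + x) ^ (pairs V).card) :=
          mul_le_mul_of_nonneg_left (mul_le_mul_of_nonneg_left h1 (pow_nonneg hx0 _)) (hW0 q)
      _ = _ := by
          simp only [W, mul_pow, pow_add, pow_mul]
          ring
  have hinner : ∀ T C, (coreEdges T C).card ≤ 2 * n → ∑ D : pairs V → Finset V,
      (x ^ (baseEdges D \ coreEdges T C).card * (w * x ^ 2) ^ ∑ e, (D e).card) ≤ K := by
    intro T C hcore
    refine (sum_attachments_le hx0 (by positivity) _).trans ?_
    refine mul_le_mul_of_nonneg_right (pow_le_pow_right₀ hβ1 hcore) ?_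
    have := mul_nonneg hx0 (sub_nonneg.2 hβ1)
    positivity
  have hTT : ∑ T ∈ TT, (x * w) ^ (3 * T.card) = ∑ k ∈ Finset.range (n + 1),
      ((packings (Finset.univ : Finset V) k).card : ℝ) * (x * w) ^ (3 * k) := by
    rw [Finset.sum_biUnion]
    · refine Finset.sum_congr rfl fun k _ => ?_
      rw [Finset.sum_congr rfl fun T hT => by rw [(mem_packings.1 hT).2.1], Finset.sum_const,
        nsmul_eq_mul]
    · intro k _ k' _ hne
      rw [Function.onFun, Finset.disjoint_left]
      exact fun T hT hT' => hne ((mem_packings.1 hT).2.1.symm.trans (mem_packings.1 hT').2.1)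
  have hCC : ∑ C ∈ CC, (x ^ 3 * w ^ 2) ^ C.card = (1 + x ^ 3 * w ^ 2) ^ (n * (pairs V).card) := by
    rw [sum_powerset_pow_card, Finset.card_product, Finset.card_univ]
  calc partitionSum V x w
      ≤ ∑ q ∈ Q, (1 + x) ^ (pairs V).card * ((x * w) ^ (3 * q.1.card) *
        ((x ^ 3 * w ^ 2) ^ q.2.1.card * (x ^ (baseEdges q.2.2 \ coreEdges q.1 q.2.1).card *
          (w * x ^ 2) ^ ∑ e, (q.2.2 e).card))) := hstep1.trans (Finset.sum_le_sum hstep2)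
    _ = (1 + x) ^ (pairs V).card * ∑ q ∈ Q, ((x * w) ^ (3 * q.1.card) *
        ((x ^ 3 * w ^ 2) ^ q.2.1.card * (x ^ (baseEdges q.2.2 \ coreEdges q.1 q.2.1).card *
          (w * x ^ 2) ^ ∑ e, (q.2.2 e).card))) := by rw [Finset.mul_sum]
    _ ≤ (1 + x) ^ (pairs V).card * ∑ T ∈ TT, ∑ C ∈ CC, ((x * w) ^ (3 * T.card) *
        ((x ^ 3 * w ^ 2) ^ C.card * K)) := by
        refine mul_le_mul_of_nonneg_left ?_ (by positivity)
        rw [Finset.sum_filter, Finset.sum_product]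
        refine Finset.sum_le_sum fun T _ => ?_
        rw [Finset.sum_product]
        refine Finset.sum_le_sum fun C _ => ?_
        by_cases hcore : (coreEdges T C).card ≤ 2 * n
        · calc _ ≤ ∑ D : pairs V → Finset V, ((x * w) ^ (3 * T.card) *
                ((x ^ 3 * w ^ 2) ^ C.card * (x ^ (baseEdges D \ coreEdges T C).card *
                (w * x ^ 2) ^ ∑ e, (D e).card))) := by
                refine Finset.sum_le_sum fun D _ => ?_
                split_ifs
                · exact le_rfl
                · positivity
            _ ≤ _ := by
                rw [← Finset.mul_sum, ← Finset.mul_sum]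
                have := hinner T C hcore
                gcongr
        · rw [Finset.sum_eq_zero fun D _ => if_neg fun h => hcore h.1]
          positivity
    _ = _ := by
        simp_rw [← Finset.mul_sum]
        rw [← Finset.sum_mul, hTT, ← Finset.sum_mul, hCC]

end Bounds

section LowerBound

variable {V : Type*} [Fintype V] [DecidableEq V]

/-! ### The lower bound for the partition function -/

/-- The edges of the triangles in `T`. -/
def familyEdges (T : Finset (Finset V)) : Finset (Finset V) :=
  T.biUnion (Finset.powersetCard 2)

theorem card_familyEdges {k : ℕ} {T : Finset (Finset V)} (hT : T ∈ packings Finset.univ k) :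
    (familyEdges T).card = 3 * k := by
  obtain ⟨h1, h2, h3⟩ := mem_packings.1 hT
  have h : IsCore T ∅ := ⟨fun t ht => (h1 t ht).2, h3, by simp, by simp, by simp, by simp⟩
  simpa [coreEdges, familyEdges, h2] using h.card_coreEdges

theorem familyEdges_subset_pairs (T : Finset (Finset V)) : familyEdges T ⊆ pairs V :=
  Finset.biUnion_subset.2 fun _ _ _ hf => mem_pairs.2 (Finset.mem_powersetCard.1 hf).2

theorem subset_triangles {k : ℕ} {T A : Finset (Finset V)} (hT : T ∈ packings Finset.univ k)
    (hA : familyEdges T ⊆ A) : T ⊆ triangles A := fun t ht =>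
  mem_triangles.2 ⟨((mem_packings.1 hT).1 t ht).2,
    (Finset.subset_biUnion_of_mem (Finset.powersetCard 2) ht).trans hA⟩

/-- A triple outside a disjoint family `T` shares at most one edge with `T`: two of its edges meet,
and would belong to the same member of `T`. -/
theorem card_inter_familyEdges_le {k : ℕ} {T : Finset (Finset V)}
    (hT : T ∈ packings Finset.univ k) {t : Finset V} (ht : t.card = 3) (htT : t ∉ T) :
    (t.powersetCard 2 ∩ familyEdges T).card ≤ 1 := by
  obtain ⟨h1, -, h3⟩ := mem_packings.1 hT
  rw [Finset.card_le_one]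
  intro e he e' he'
  by_contra hne
  simp only [familyEdges, Finset.mem_inter, Finset.mem_powersetCard, Finset.mem_biUnion] at he he'
  obtain ⟨⟨het, hec⟩, s, hs, hes, -⟩ := he
  obtain ⟨⟨het', hec'⟩, s', hs', hes', -⟩ := he'
  have hlt : 2 < (e ∪ e').card := by
    by_contra hle
    have e1 := Finset.eq_of_subset_of_card_le (Finset.subset_union_left : e ⊆ e ∪ e') (by omega)
    have e2 := Finset.eq_of_subset_of_card_le (Finset.subset_union_right : e' ⊆ e ∪ e') (by omega)
    exact hne (e1.trans e2.symm)
  have hun : e ∪ e' = t :=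
    Finset.eq_of_subset_of_card_le (Finset.union_subset het het') (by omega)
  have hint : (e ∩ e').Nonempty := by
    have := Finset.card_union_add_card_inter e e'
    rw [hun] at this
    rw [← Finset.card_pos]; omega
  obtain ⟨y, hy⟩ := hint
  rw [Finset.mem_inter] at hy
  have hss : s = s' := by
    by_contra hss
    exact Finset.disjoint_left.1 (h3 hs hs' hss) (hes hy.1) (hes' hy.2)
  subst hss
  have : t = s := Finset.eq_of_subset_of_card_le (hun ▸ Finset.union_subset hes hes')
    (by rw [(h1 s hs).2, ht])
  exact htT (this ▸ hs)

/-- The expected number of additional triangles in a random graph with edge weight `x` in which the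
family `T` has been planted. -/
theorem sum_missing_edges_le {x : ℝ} (hx : 0 ≤ x) {k : ℕ} {T : Finset (Finset V)}
    (hT : T ∈ packings Finset.univ k) :
    ∑ t ∈ (Finset.univ.powersetCard 3) \ T, x ^ (t.powersetCard 2 \ familyEdges T).card ≤
      (Fintype.card V * x) ^ 2 + (Fintype.card V * x) ^ 3 := by
  set n := Fintype.card V with hn
  set H := familyEdges T with hH
  have hcardle : 3 * k ≤ n := by
    rw [← card_biUnion_of_mem_packings hT]; exact Finset.card_le_univ _
  obtain ⟨I, hI⟩ : ∃ I : Finset (Finset V), I = (H ×ˢ Finset.univ).image fun q => insert q.2 q.1 :=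
    ⟨_, rfl⟩
  have hdiff : ∀ t : Finset V, t.card = 3 →
      (t.powersetCard 2 \ H).card + (t.powersetCard 2 ∩ H).card = 3 := by
    intro t ht
    rw [Finset.card_sdiff_add_card_inter, Finset.card_powersetCard, ht]; rfl
  have hterm : ∀ t ∈ (Finset.univ.powersetCard 3) \ T,
      x ^ (t.powersetCard 2 \ H).card ≤ x ^ 3 +
        if t ∈ I then x ^ 2 else 0 := by
    intro t ht
    simp only [Finset.mem_sdiff, Finset.mem_powersetCard, Finset.subset_univ, true_and] at ht
    have h1 := card_inter_familyEdges_le hT ht.1 ht.2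
    have h2 := hdiff t ht.1
    rcases Nat.eq_zero_or_pos (t.powersetCard 2 ∩ H).card with h0 | h0
    · rw [show (t.powersetCard 2 \ H).card = 3 by omega]
      have : (0 : ℝ) ≤ x ^ 2 := sq_nonneg x
      split_ifs <;> linarith
    · rw [show (t.powersetCard 2 \ H).card = 2 by rw [← hH] at h1; omega, if_pos]
      · have : (0 : ℝ) ≤ x ^ 3 := pow_nonneg hx 3
        linarith
      · obtain ⟨e, he⟩ := Finset.card_pos.1 h0
        rw [Finset.mem_inter, Finset.mem_powersetCard] at he
        obtain ⟨⟨het, hec⟩, heH⟩ := he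
        obtain ⟨v, hv⟩ : (t \ e).Nonempty := by
          rw [← Finset.card_pos, Finset.card_sdiff_of_subset het]; omega
        rw [Finset.mem_sdiff] at hv
        rw [hI]
        refine Finset.mem_image.2 ⟨(e, v), by simp [heH], ?_⟩
        refine Finset.eq_of_subset_of_card_le (Finset.insert_subset hv.1 het) ?_
        rw [Finset.card_insert_of_notMem hv.2]; omega
  have hc1 : ((((Finset.univ : Finset V).powersetCard 3) \ T).card : ℝ) ≤ (n : ℝ) ^ 3 := by
    have : (((Finset.univ : Finset V).powersetCard 3) \ T).card ≤ n ^ 3 := by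
      refine (Finset.card_le_card Finset.sdiff_subset).trans ?_
      rw [Finset.card_powersetCard, Finset.card_univ]
      exact Nat.choose_le_pow _ _
    exact_mod_cast this
  have hc2 : (((((Finset.univ : Finset V).powersetCard 3) \ T).filter (· ∈ I)).card : ℝ) ≤
      (n : ℝ) ^ 2 := by
    have h1 : I.card ≤ n ^ 2 := by
      rw [hI]
      refine Finset.card_image_le.trans ?_
      rw [Finset.card_product, card_familyEdges hT, Finset.card_univ, sq]
      exact Nat.mul_le_mul_right _ hcardle
    have h2 := Finset.card_le_card (s := (((Finset.univ : Finset V).powersetCard 3) \ T).filter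
      (· ∈ I)) (t := I) fun t ht => (Finset.mem_filter.1 ht).2
    exact_mod_cast h2.trans h1
  calc _ ≤ ∑ t ∈ (Finset.univ.powersetCard 3) \ T, (x ^ 3 +
        if t ∈ I then x ^ 2 else 0) :=
        Finset.sum_le_sum hterm
    _ = ((((Finset.univ : Finset V).powersetCard 3) \ T).card : ℝ) * x ^ 3 +
        (((((Finset.univ : Finset V).powersetCard 3) \ T).filter (· ∈ I)).card : ℝ) * x ^ 2 := by
        rw [Finset.sum_add_distrib, Finset.sum_const, nsmul_eq_mul, ← Finset.sum_filter,
          Finset.sum_const, nsmul_eq_mul]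
    _ ≤ (n : ℝ) ^ 3 * x ^ 3 + (n : ℝ) ^ 2 * x ^ 2 := by gcongr
    _ = _ := by ring

/-- Markov's inequality: the graphs that contain the family `T` and at most `L` further triangles
have at least half of the weight of all graphs that contain `T`. -/
theorem le_sum_few_triangles {x : ℝ} (hx : 0 ≤ x) {k L : ℕ}
    (hL : 2 * ((Fintype.card V * x) ^ 2 + (Fintype.card V * x) ^ 3) ≤ L + 1)
    {T : Finset (Finset V)} (hT : T ∈ packings Finset.univ k) :
    x ^ (3 * k) * (1 + x) ^ ((pairs V).card - 3 * k) ≤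
      2 * ∑ A ∈ (pairs V).powerset with familyEdges T ⊆ A,
        x ^ A.card * if (triangles A).card ≤ k + L then 1 else 0 := by
  set H := familyEdges T with hH
  set N := (pairs V).card with hN
  have hHP : H ⊆ pairs V := familyEdges_subset_pairs T
  have hPH : (pairs V \ H).card = N - 3 * k := by
    rw [Finset.card_sdiff_of_subset hHP, card_familyEdges hT]
  rw [sum_filter_superset hHP x, card_familyEdges hT]
  have hextra : ∀ B : Finset (Finset V), ((triangles (H ∪ B)).card : ℝ) - k =
      ∑ t ∈ (Finset.univ.powersetCard 3) \ T, if t.powersetCard 2 \ H ⊆ B then 1 else 0 := by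
    intro B
    have hsub : T ⊆ triangles (H ∪ B) := subset_triangles hT Finset.subset_union_left
    have hset : triangles (H ∪ B) \ T = ((Finset.univ.powersetCard 3) \ T).filter fun t =>
        t.powersetCard 2 \ H ⊆ B := by
      ext t
      have hiff : t.powersetCard 2 \ H ⊆ B ↔ t.powersetCard 2 ⊆ H ∪ B := sdiff_le_iff
      simp only [triangles, Finset.mem_sdiff, Finset.mem_filter, hiff]
      tauto
    rw [Finset.sum_boole, ← hset, Finset.card_sdiff_of_subset hsub,
      Nat.cast_sub (Finset.card_le_card hsub), (mem_packings.1 hT).2.1]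
  have hexp : ∑ B ∈ (pairs V \ H).powerset, x ^ B.card * (((triangles (H ∪ B)).card : ℝ) - k) ≤
      (1 + x) ^ (N - 3 * k) * ((Fintype.card V * x) ^ 2 + (Fintype.card V * x) ^ 3) := by
    calc _ = ∑ t ∈ (Finset.univ.powersetCard 3) \ T,
          ∑ B ∈ (pairs V \ H).powerset with t.powersetCard 2 \ H ⊆ B, x ^ B.card := by
          simp_rw [hextra, Finset.mul_sum]
          rw [Finset.sum_comm]
          refine Finset.sum_congr rfl fun t _ => ?_
          rw [Finset.sum_filter]
          refine Finset.sum_congr rfl fun B _ => ?_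
          split_ifs <;> simp
      _ ≤ ∑ t ∈ (Finset.univ.powersetCard 3) \ T,
          (1 + x) ^ (N - 3 * k) * x ^ (t.powersetCard 2 \ H).card := by
          refine Finset.sum_le_sum fun t _ => ?_
          rw [sum_filter_superset_pow_card, hPH, mul_comm]
          · have := pow_le_pow_right₀ (show (1 : ℝ) ≤ 1 + x by linarith)
              (Nat.sub_le (N - 3 * k) (t.powersetCard 2 \ H).card)
            exact mul_le_mul_of_nonneg_right this (pow_nonneg hx _)
          · refine Finset.sdiff_subset_sdiff (fun f hf => ?_) le_rfl
            exact mem_pairs.2 (Finset.mem_powersetCard.1 hf).2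
      _ ≤ _ := by
          rw [← Finset.mul_sum]
          exact mul_le_mul_of_nonneg_left (sum_missing_edges_le hx hT) (by positivity)
  have hmarkov : ∀ B : Finset (Finset V), (1 : ℝ) - (((triangles (H ∪ B)).card : ℝ) - k) / (L + 1) ≤
      if (triangles (H ∪ B)).card ≤ k + L then 1 else 0 := by
    intro B
    have hsub : k ≤ (triangles (H ∪ B)).card := by
      rw [← (mem_packings.1 hT).2.1]
      exact Finset.card_le_card (subset_triangles hT Finset.subset_union_left)
    have hL0 : (0 : ℝ) < L + 1 := by positivity
    split_ifs with h
    · have : (0 : ℝ) ≤ (((triangles (H ∪ B)).card : ℝ) - k) / (L + 1) :=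
        div_nonneg (sub_nonneg.2 (by exact_mod_cast hsub)) hL0.le
      linarith
    · have h2 : k + L + 1 ≤ (triangles (H ∪ B)).card := by omega
      have h3 : (k : ℝ) + L + 1 ≤ (triangles (H ∪ B)).card := by exact_mod_cast h2
      have : (1 : ℝ) ≤ (((triangles (H ∪ B)).card : ℝ) - k) / (L + 1) := by
        rw [le_div_iff₀ hL0]; linarith
      linarith
  have hmain : (1 + x) ^ (N - 3 * k) ≤ 2 * ∑ B ∈ (pairs V \ H).powerset,
      x ^ B.card * if (triangles (H ∪ B)).card ≤ k + L then (1 : ℝ) else 0 := by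
    have h1 : ∑ B ∈ (pairs V \ H).powerset,
        x ^ B.card * ((1 : ℝ) - (((triangles (H ∪ B)).card : ℝ) - k) / (L + 1)) ≤
        ∑ B ∈ (pairs V \ H).powerset,
        x ^ B.card * if (triangles (H ∪ B)).card ≤ k + L then (1 : ℝ) else 0 :=
      Finset.sum_le_sum fun B _ => mul_le_mul_of_nonneg_left (hmarkov B) (pow_nonneg hx _)
    have h2 : ∑ B ∈ (pairs V \ H).powerset,
        x ^ B.card * ((1 : ℝ) - (((triangles (H ∪ B)).card : ℝ) - k) / (L + 1)) =
        (1 + x) ^ (N - 3 * k) - (∑ B ∈ (pairs V \ H).powerset,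
          x ^ B.card * (((triangles (H ∪ B)).card : ℝ) - k)) / (L + 1) := by
      rw [Finset.sum_div, ← hPH, ← sum_powerset_pow_card, ← Finset.sum_sub_distrib]
      exact Finset.sum_congr rfl fun B _ => by ring
    have hp : (0 : ℝ) < (1 + x) ^ (N - 3 * k) := by positivity
    have h3 : (∑ B ∈ (pairs V \ H).powerset,
        x ^ B.card * (((triangles (H ∪ B)).card : ℝ) - k)) / (L + 1) ≤
        (1 + x) ^ (N - 3 * k) / 2 := by
      rw [div_le_div_iff₀ (by positivity) two_pos]
      nlinarith
    linarith
  calc _ ≤ x ^ (3 * k) * (2 * ∑ B ∈ (pairs V \ H).powerset,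
        x ^ B.card * if (triangles (H ∪ B)).card ≤ k + L then (1 : ℝ) else 0) :=
        mul_le_mul_of_nonneg_left hmain (pow_nonneg hx _)
    _ = _ := by ring

/-- A graph with at most `k + L` triangles contains at most `(k + L) ^ L` families of `k` disjoint
triangles, so that counting families instead of graphs loses only a polynomial factor. -/
theorem le_partitionSum {x w : ℝ} (hx : 0 ≤ x) (hw : 1 ≤ w) {k L : ℕ}
    (hL : 2 * ((Fintype.card V * x) ^ 2 + (Fintype.card V * x) ^ 3) ≤ L + 1) :
    ((packings (Finset.univ : Finset V) k).card : ℝ) * (x * w) ^ (3 * k) *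
      (1 + x) ^ ((pairs V).card - 3 * k) ≤ 2 * ((k + L : ℕ) : ℝ) ^ L * partitionSum V x w := by
  set N := (pairs V).card with hN
  have hgraph : ∀ A : Finset (Finset V),
      ∑ T ∈ packings (Finset.univ : Finset V) k, (if familyEdges T ⊆ A then
        w ^ (3 * k) * (if (triangles A).card ≤ k + L then (1 : ℝ) else 0) else 0) ≤
      ((k + L : ℕ) : ℝ) ^ L * w ^ (triangleVerts A).card := by
    intro A
    have hR : 0 ≤ ((k + L : ℕ) : ℝ) ^ L * w ^ (triangleVerts A).card := by positivity
    rw [← Finset.sum_filter, Finset.sum_const, nsmul_eq_mul]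
    split_ifs with htri
    · rcases ((packings (Finset.univ : Finset V) k).filter
        fun T => familyEdges T ⊆ A).eq_empty_or_nonempty with h0 | ⟨T, hT⟩
      · rw [h0]; simpa using hR
      · rw [Finset.mem_filter] at hT
        have hcard : 3 * k ≤ (triangleVerts A).card := by
          rw [← card_biUnion_of_mem_packings hT.1]
          exact Finset.card_le_card
            (Finset.biUnion_subset_biUnion_of_subset_left _ (subset_triangles hT.1 hT.2))
        have hnum : ((packings (Finset.univ : Finset V) k).filter
            fun T => familyEdges T ⊆ A).card ≤ (k + L) ^ L := by
          calc _ ≤ ((triangles A).powersetCard k).card := by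
                refine Finset.card_le_card fun T' hT' => ?_
                rw [Finset.mem_filter] at hT'
                exact Finset.mem_powersetCard.2 ⟨subset_triangles hT'.1 hT'.2,
                  (mem_packings.1 hT'.1).2.1⟩
            _ = (triangles A).card.choose k := Finset.card_powersetCard _ _
            _ ≤ (k + L).choose k := Nat.choose_le_choose _ htri
            _ = (k + L).choose L := by rw [Nat.choose_symm_add]
            _ ≤ (k + L) ^ L := Nat.choose_le_pow _ _
        have hnum' : (((packings (Finset.univ : Finset V) k).filter
            fun T => familyEdges T ⊆ A).card : ℝ) ≤ ((k + L : ℕ) : ℝ) ^ L := by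
          exact_mod_cast hnum
        rw [mul_one]
        exact mul_le_mul hnum' (pow_le_pow_right₀ hw hcard) (by positivity) (by positivity)
    · simpa using hR
  have hsum : ∑ T ∈ packings (Finset.univ : Finset V) k, w ^ (3 * k) *
      ∑ A ∈ (pairs V).powerset with familyEdges T ⊆ A,
        x ^ A.card * (if (triangles A).card ≤ k + L then (1 : ℝ) else 0) ≤
      ((k + L : ℕ) : ℝ) ^ L * partitionSum V x w := by
    calc _ = ∑ A ∈ (pairs V).powerset, x ^ A.card *
          ∑ T ∈ packings (Finset.univ : Finset V) k, (if familyEdges T ⊆ A then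
          w ^ (3 * k) * (if (triangles A).card ≤ k + L then (1 : ℝ) else 0) else 0) := by
          simp_rw [Finset.mul_sum, Finset.sum_filter]
          rw [Finset.sum_comm]
          refine Finset.sum_congr rfl fun A _ => Finset.sum_congr rfl fun T _ => ?_
          by_cases h : familyEdges T ⊆ A
          · simp only [h, if_true]; ring
          · simp only [h, if_false]; ring
      _ ≤ ∑ A ∈ (pairs V).powerset, x ^ A.card *
          (((k + L : ℕ) : ℝ) ^ L * w ^ (triangleVerts A).card) :=
          Finset.sum_le_sum fun A _ => mul_le_mul_of_nonneg_left (hgraph A) (pow_nonneg hx _)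
      _ = _ := by
          rw [partitionSum, Finset.mul_sum]
          exact Finset.sum_congr rfl fun A _ => by ring
  calc _ = ∑ T ∈ packings (Finset.univ : Finset V) k,
        w ^ (3 * k) * (x ^ (3 * k) * (1 + x) ^ (N - 3 * k)) := by
        rw [Finset.sum_const, nsmul_eq_mul, mul_pow]; ring
    _ ≤ ∑ T ∈ packings (Finset.univ : Finset V) k, w ^ (3 * k) *
        (2 * ∑ A ∈ (pairs V).powerset with familyEdges T ⊆ A,
        x ^ A.card * (if (triangles A).card ≤ k + L then (1 : ℝ) else 0)) :=
        Finset.sum_le_sum fun T hT =>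
          mul_le_mul_of_nonneg_left (le_sum_few_triangles hx hL hT) (by positivity)
    _ = 2 * ∑ T ∈ packings (Finset.univ : Finset V) k, w ^ (3 * k) *
        ∑ A ∈ (pairs V).powerset with familyEdges T ⊆ A,
        x ^ A.card * (if (triangles A).card ≤ k + L then (1 : ℝ) else 0) := by
        rw [Finset.mul_sum]
        exact Finset.sum_congr rfl fun T _ => by ring
    _ ≤ 2 * (((k + L : ℕ) : ℝ) ^ L * partitionSum V x w) :=
        mul_le_mul_of_nonneg_left hsum two_pos.le
    _ = _ := by ring

end LowerBound

/-! ### The free energy in the critical window -/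

theorem card_pairs_fin (n : ℕ) : ((pairs (Fin n)).card : ℝ) = n * (n - 1) / 2 := by
  rw [pairs, Finset.card_powersetCard, Finset.card_univ, Fintype.card_fin, Nat.cast_choose_two]

theorem partitionSum_pos {V : Type*} [Fintype V] [DecidableEq V] {x w : ℝ} (hx : 0 ≤ x)
    (hw : 0 < w) : 0 < partitionSum V x w := by
  unfold partitionSum
  refine Finset.sum_pos' (fun A _ => by positivity) ⟨∅, by simp, ?_⟩
  simpa using pow_pos hw _

theorem Lam_eq_add_log (b θ u ℓ : ℝ) :
    Lam b θ u = Lam b θ ℓ + b * (Real.log u - Real.log ℓ) := by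
  unfold Lam; ring

/-- The weight of a triangle vertex in the critical window, `n^β = n^(1/3) e^θ`. -/
noncomputable def vertexWeight (θ : ℝ) (n : ℕ) : ℝ :=
  Real.exp (θ + Real.log n / 3)

theorem log_div_mul_vertexWeight {u : ℝ} (hu : 0 < u) {n : ℕ} (hn : 0 < n) (θ : ℝ) :
    Real.log (u / n * vertexWeight θ n) = Real.log u + θ - 2 / 3 * Real.log n := by
  have hn' : (0 : ℝ) < n := by exact_mod_cast hn
  rw [vertexWeight, Real.log_mul (by positivity) (Real.exp_pos _).ne',
    Real.log_div hu.ne' hn'.ne', Real.log_exp]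
  ring

theorem vertexWeight_eq {n : ℕ} (hn : 0 < n) (θ : ℝ) :
    vertexWeight θ n = Real.exp θ * Real.exp (-(Real.log n / 3)) ^ 2 * n := by
  have hn' : (0 : ℝ) < n := by exact_mod_cast hn
  conv_rhs => rw [← Real.exp_log hn', ← Real.exp_nat_mul, ← Real.exp_add, ← Real.exp_add]
  rw [vertexWeight, Real.log_exp]
  push_cast; ring_nf

theorem cube_exp_neg_log {n : ℕ} (hn : 0 < n) :
    Real.exp (-(Real.log n / 3)) ^ 3 * n = 1 := by
  have hn' : (0 : ℝ) < n := by exact_mod_cast hn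
  have h : Real.exp (-(Real.log n / 3)) ^ 3 = (n : ℝ)⁻¹ := by
    rw [← Real.exp_nat_mul, ← Real.exp_log (inv_pos.2 hn'), Real.log_inv]
    push_cast; ring_nf
  rw [h, inv_mul_cancel₀ hn'.ne']

/-- Explicit upper bound for the free energy of the families of disjoint triangles. -/
theorem log_sum_packings_le {a ℓ u : ℝ} (h0 : 0 < a) (h1 : a < 1) (hu : 0 < u) {n : ℕ}
    (hn : 0 < n) :
    Real.log (∑ k ∈ Finset.range (n + 1), ((packings (Finset.univ : Finset (Fin n)) k).card : ℝ) *
      (u / n * vertexWeight (dualParam a ℓ) n) ^ (3 * k)) ≤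
      n * (maxVal a + |Real.log u - Real.log ℓ|) + 2 * (1 + Real.log (n + 1))
        + Real.log (n + 1) := by
  set θ := dualParam a ℓ with hθ
  have hn' : (0 : ℝ) < n := by exact_mod_cast hn
  have hq : 0 < u / n * vertexWeight θ n := mul_pos (by positivity) (Real.exp_pos _)
  set R := n * (maxVal a + |Real.log u - Real.log ℓ|) + 2 * (1 + Real.log (n + 1)) with hR
  have hcardV : (Finset.univ : Finset (Fin n)).card = n := by simp
  have hterm : ∀ k ∈ Finset.range (n + 1),
      ((packings (Finset.univ : Finset (Fin n)) k).card : ℝ) *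
      (u / n * vertexWeight θ n) ^ (3 * k) ≤ Real.exp R := by
    intro k _
    by_cases hk : 3 * k ≤ n
    · have hc : (0 : ℝ) < (packings (Finset.univ : Finset (Fin n)) k).card := by
        exact_mod_cast card_packings_pos _ (by rwa [hcardV])
      rw [← Real.log_le_iff_le_exp (by positivity), Real.log_mul hc.ne' (by positivity),
        Real.log_pow, log_div_mul_vertexWeight hu hn]
      have h := (abs_le.1 (abs_log_card_packings_sub_le (Finset.univ : Finset (Fin n))
        (by rwa [hcardV]) (by rwa [hcardV]) θ (k := k) (ℓ := u))).2
      rw [hcardV] at h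
      have hkn : (3 * k : ℝ) ≤ n := by exact_mod_cast hk
      have hb : (3 * k / n : ℝ) ∈ Set.Icc (0 : ℝ) 1 :=
        ⟨by positivity, (div_le_one hn').2 hkn⟩
      have hΛ : Lam (3 * k / n) θ u ≤ maxVal a + |Real.log u - Real.log ℓ| := by
        rw [Lam_eq_add_log _ _ u ℓ]
        refine add_le_add (Lam_le_maxVal h0 h1 hb ℓ) ?_
        calc (3 * k / n : ℝ) * (Real.log u - Real.log ℓ)
            ≤ 3 * k / n * |Real.log u - Real.log ℓ| :=
              mul_le_mul_of_nonneg_left (le_abs_self _) hb.1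
          _ ≤ 1 * |Real.log u - Real.log ℓ| :=
              mul_le_mul_of_nonneg_right hb.2 (abs_nonneg _)
          _ = _ := one_mul _
      have := mul_le_mul_of_nonneg_left hΛ hn'.le
      push_cast at h ⊢
      linarith
    · have hempty : packings (Finset.univ : Finset (Fin n)) k = ∅ := by
        refine Finset.eq_empty_of_forall_notMem fun T hT => hk ?_
        rw [← card_biUnion_of_mem_packings hT]
        exact (Finset.card_le_univ _).trans (by simp)
      rw [hempty]
      simpa using (Real.exp_pos R).le
  have hpos : (0 : ℝ) < ∑ k ∈ Finset.range (n + 1),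
      ((packings (Finset.univ : Finset (Fin n)) k).card : ℝ) *
      (u / n * vertexWeight θ n) ^ (3 * k) := by
    refine Finset.sum_pos' (fun k _ => by positivity) ⟨0, by simp, ?_⟩
    have : 0 < (packings (Finset.univ : Finset (Fin n)) 0).card :=
      card_packings_pos _ (by simp)
    simpa using this
  have hsum := Finset.sum_le_card_nsmul _ _ _ hterm
  rw [Finset.card_range, nsmul_eq_mul] at hsum
  have := Real.log_le_log hpos hsum
  rw [Real.log_mul (by positivity) (Real.exp_pos _).ne', Real.log_exp] at this
  push_cast at this
  linarith

/-- Explicit upper bound for the free energy. With `r = n^(-1/3)`, all terms but `u / 2` and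
`maxVal a` tend to zero as `u → ℓ` and `n → ∞`. -/
theorem log_partitionSum_le {a ℓ u : ℝ} (h0 : 0 < a) (h1 : a < 1) (hu : 0 < u) {n : ℕ}
    (hn : 0 < n) :
    Real.log (partitionSum (Fin n) (u / n) (vertexWeight (dualParam a ℓ) n)) / n ≤
      u / 2 + (maxVal a + |Real.log u - Real.log ℓ| + (2 + 3 * Real.log (n + 1)) / n)
      + u ^ 3 * Real.exp (dualParam a ℓ) ^ 2 * Real.exp (-(Real.log n / 3)) / 2
      + 2 * (u ^ 2 * Real.exp (dualParam a ℓ) * Real.exp (-(Real.log n / 3)) ^ 2)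
      + u / 2 *
        (Real.exp (u ^ 2 * Real.exp (dualParam a ℓ) * Real.exp (-(Real.log n / 3)) ^ 2) - 1) := by
  set θ := dualParam a ℓ with hθ
  set w := vertexWeight θ n with hw
  set r := Real.exp (-(Real.log n / 3)) with hr
  have hr0 : 0 < r := Real.exp_pos _
  have hn' : (0 : ℝ) < n := by exact_mod_cast hn
  have hw0 : 0 < w := Real.exp_pos _
  have hwr : w = Real.exp θ * r ^ 2 * n := vertexWeight_eq hn θ
  have hr3 : r ^ 3 * n = 1 := cube_exp_neg_log hn
  set x := u / n with hx
  have hx0 : 0 < x := by positivity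
  have hxn : x * n = u := by rw [hx]; field_simp
  set N := (pairs (Fin n)).card with hN
  have hNle : (N : ℝ) ≤ n ^ 2 / 2 := by
    rw [hN, card_pairs_fin]; nlinarith
  have hN0 : (0 : ℝ) ≤ N := by positivity
  set β := (1 + w * x ^ 2) ^ n with hβ
  have hβ1 : 1 ≤ β := one_le_pow₀ (by have : 0 ≤ w * x ^ 2 := by positivity
                                      linarith)
  have hlogβ : Real.log β ≤ u ^ 2 * Real.exp θ * r ^ 2 := by
    rw [hβ, Real.log_pow]
    have h := Real.log_le_sub_one_of_pos (show 0 < 1 + w * x ^ 2 by positivity)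
    calc n * Real.log (1 + w * x ^ 2) ≤ n * (w * x ^ 2) :=
          mul_le_mul_of_nonneg_left (by linarith) hn'.le
      _ = u ^ 2 * Real.exp θ * r ^ 2 := by rw [hwr, ← hxn]; ring
  have hβle : β ≤ Real.exp (u ^ 2 * Real.exp θ * r ^ 2) :=
    (Real.log_le_iff_le_exp (by linarith)).1 hlogβ
  have hmain := partitionSum_le (V := Fin n) hx0.le hw0.le
  rw [Fintype.card_fin] at hmain
  set Sp := ∑ k ∈ Finset.range (n + 1), ((packings (Finset.univ : Finset (Fin n)) k).card : ℝ) *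
      (x * w) ^ (3 * k) with hSp
  have hSpos : 0 < Sp := by
    refine Finset.sum_pos' (fun k _ => by positivity) ⟨0, by simp, ?_⟩
    have : 0 < (packings (Finset.univ : Finset (Fin n)) 0).card :=
      card_packings_pos _ (by simp)
    simpa using this
  have hγ0 : 0 ≤ x * (β - 1) := mul_nonneg hx0.le (sub_nonneg.2 hβ1)
  have hβ0 : 0 < β := by linarith
  obtain ⟨δ, hδ⟩ : ∃ δ, δ = 1 + x * (β - 1) := ⟨_, rfl⟩
  have hδ0 : 0 < δ := by linarith
  rw [← hβ, ← hN, ← hδ] at hmain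
  clear_value β Sp N
  have hlog := Real.log_le_log (partitionSum_pos hx0.le hw0) hmain
  rw [Real.log_mul (by positivity) (by positivity), Real.log_mul (by positivity) (by positivity),
    Real.log_mul (by positivity) (by positivity), Real.log_mul (by positivity) (by positivity),
    Real.log_pow, Real.log_pow, Real.log_pow, Real.log_pow] at hlog
  have t1 : N * Real.log (1 + x) ≤ n * (u / 2) := by
    have h := Real.log_le_sub_one_of_pos (show 0 < 1 + x by positivity)
    calc N * Real.log (1 + x) ≤ n ^ 2 / 2 * x :=
          mul_le_mul hNle (by linarith) (Real.log_nonneg (by linarith)) (by positivity)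
      _ = _ := by rw [← hxn]; ring
  have t2 := log_sum_packings_le (ℓ := ℓ) h0 h1 hu hn
  rw [← hθ, ← hw, ← hx, ← hSp] at t2
  have t3 : ((n * N : ℕ) : ℝ) * Real.log (1 + x ^ 3 * w ^ 2) ≤
      n * (u ^ 3 * Real.exp θ ^ 2 * r / 2) := by
    have h := Real.log_le_sub_one_of_pos (show 0 < 1 + x ^ 3 * w ^ 2 by positivity)
    push_cast
    calc (n : ℝ) * N * Real.log (1 + x ^ 3 * w ^ 2) ≤ n * (n ^ 2 / 2) * (x ^ 3 * w ^ 2) := by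
          refine mul_le_mul (mul_le_mul_of_nonneg_left hNle hn'.le) (by linarith)
            (Real.log_nonneg ?_) (by positivity)
          have : 0 ≤ x ^ 3 * w ^ 2 := by positivity
          linarith
      _ = n * (u ^ 3 * Real.exp θ ^ 2 * r / 2) * (r ^ 3 * n) := by rw [hwr, ← hxn]; ring
      _ = _ := by rw [hr3, mul_one]
  have t4 : ((2 * n : ℕ) : ℝ) * Real.log β ≤ n * (2 * (u ^ 2 * Real.exp θ * r ^ 2)) := by
    push_cast
    have := mul_le_mul_of_nonneg_left hlogβ hn'.le
    linarith
  have t5 : N * Real.log δ ≤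
      n * (u / 2 * (Real.exp (u ^ 2 * Real.exp θ * r ^ 2) - 1)) := by
    have h := Real.log_le_sub_one_of_pos hδ0
    calc N * Real.log δ ≤ n ^ 2 / 2 * (x * (β - 1)) :=
          mul_le_mul hNle (by linarith) (Real.log_nonneg (by linarith)) (by positivity)
      _ ≤ n ^ 2 / 2 * (x * (Real.exp (u ^ 2 * Real.exp θ * r ^ 2) - 1)) := by gcongr
      _ = _ := by rw [← hxn]; ring
  rw [div_le_iff₀ hn']
  have hd : (2 + 3 * Real.log ((n : ℝ) + 1)) / n * n = 2 + 3 * Real.log (n + 1) := by field_simp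
  have e1 : (u / 2 + (maxVal a + |Real.log u - Real.log ℓ| + (2 + 3 * Real.log (n + 1)) / n)
      + u ^ 3 * Real.exp θ ^ 2 * r / 2 + 2 * (u ^ 2 * Real.exp θ * r ^ 2)
      + u / 2 * (Real.exp (u ^ 2 * Real.exp θ * r ^ 2) - 1)) * n =
      n * (u / 2) + (n * (maxVal a + |Real.log u - Real.log ℓ|) + (2 + 3 * Real.log (n + 1)))
      + n * (u ^ 3 * Real.exp θ ^ 2 * r / 2) + n * (2 * (u ^ 2 * Real.exp θ * r ^ 2))
      + n * (u / 2 * (Real.exp (u ^ 2 * Real.exp θ * r ^ 2) - 1)) := by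
    linear_combination hd
  rw [e1]
  linarith

/-- Explicit lower bound for the free energy, from the families of `k` disjoint triangles. -/
theorem le_log_partitionSum {θ ℓ u : ℝ} (hu : 0 < u) {n k L : ℕ} (hn : 3 ≤ n) (hk : 3 * k ≤ n)
    (hθ : 0 ≤ θ + Real.log n / 3) (hL : 2 * (u ^ 2 + u ^ 3) ≤ L + 1) :
    Lam (3 * k / n) θ ℓ + 3 * k / n * (Real.log u - Real.log ℓ) - 2 * (1 + Real.log (n + 1)) / n
      + (u / 2 - 3 / 2 * (u / n)) / (1 + u / n) - Real.log 2 / n - L * (Real.log (n + L) / n) ≤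
    Real.log (partitionSum (Fin n) (u / n) (vertexWeight θ n)) / n := by
  set w := vertexWeight θ n with hw
  have hn0 : 0 < n := by omega
  have hn' : (0 : ℝ) < n := by exact_mod_cast hn0
  have hn3 : (3 : ℝ) ≤ n := by exact_mod_cast hn
  have hw0 : 0 < w := Real.exp_pos _
  have hw1 : 1 ≤ w := Real.one_le_exp hθ
  set x := u / n with hx
  have hx0 : 0 < x := by positivity
  have hxn : x * n = u := by rw [hx]; field_simp
  set N := (pairs (Fin n)).card with hN
  have hkn : (3 * k : ℝ) ≤ n := by exact_mod_cast hk
  have hcardV : (Finset.univ : Finset (Fin n)).card = n := by simp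
  have hmain := le_partitionSum (V := Fin n) hx0.le hw1 (k := k) (L := L) (by
    rw [Fintype.card_fin, mul_comm (n : ℝ), hxn]; exact hL)
  have hc : (0 : ℝ) < (packings (Finset.univ : Finset (Fin n)) k).card := by
    exact_mod_cast card_packings_pos _ (by rwa [hcardV])
  have hY := partitionSum_pos (V := Fin n) hx0.le hw0
  have hkL : (0 : ℝ) < ((k + L : ℕ) : ℝ) ^ L := by
    rcases Nat.eq_zero_or_pos L with rfl | h
    · simp
    · positivity
  have hlog := Real.log_le_log (by positivity) hmain
  rw [Real.log_mul (by positivity) (by positivity), Real.log_mul hc.ne' (by positivity),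
    Real.log_mul (by positivity) hY.ne', Real.log_mul two_ne_zero hkL.ne',
    Real.log_pow, Real.log_pow, Real.log_pow, log_div_mul_vertexWeight hu hn0] at hlog
  have h := (abs_le.1 (abs_log_card_packings_sub_le (Finset.univ : Finset (Fin n))
    (by rwa [hcardV]) (by rwa [hcardV]) θ (k := k) (ℓ := u))).1
  rw [hcardV, Lam_eq_add_log _ _ u ℓ] at h
  have t1 : n * ((u / 2 - 3 / 2 * x) / (1 + x)) ≤ ((N - 3 * k : ℕ) : ℝ) * Real.log (1 + x) := by
    have hlogx : x / (1 + x) ≤ Real.log (1 + x) := by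
      have := Real.one_sub_inv_le_log_of_pos (show 0 < 1 + x by positivity)
      calc x / (1 + x) = 1 - (1 + x)⁻¹ := by field_simp; ring
        _ ≤ _ := this
    have hsub : (N : ℝ) - 3 * k ≤ ((N - 3 * k : ℕ) : ℝ) := by
      have : N ≤ (N - 3 * k) + 3 * k := by omega
      have : (N : ℝ) ≤ ((N - 3 * k : ℕ) : ℝ) + 3 * k := by exact_mod_cast this
      linarith
    have hN2 : n * ((n - 1) / 2 - 1) ≤ ((N - 3 * k : ℕ) : ℝ) := by
      rw [hN, card_pairs_fin] at hsub
      nlinarith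
    calc n * ((u / 2 - 3 / 2 * x) / (1 + x)) = n * ((n - 1) / 2 - 1) * (x / (1 + x)) := by
          rw [← hxn]; field_simp; ring
      _ ≤ _ := mul_le_mul hN2 hlogx (by positivity) (by positivity)
  have t2 : L * Real.log ((k + L : ℕ) : ℝ) ≤ L * Real.log (n + L) := by
    rcases Nat.eq_zero_or_pos L with rfl | h
    · simp
    · refine mul_le_mul_of_nonneg_left (Real.log_le_log (by positivity) ?_) (by positivity)
      push_cast
      have : (0 : ℝ) ≤ k := by positivity
      linarith
  rw [le_div_iff₀ hn']
  have e1 : (Lam (3 * k / n) θ ℓ + 3 * k / n * (Real.log u - Real.log ℓ)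
      - 2 * (1 + Real.log (n + 1)) / n + (u / 2 - 3 / 2 * x) / (1 + x) - Real.log 2 / n
      - L * (Real.log (n + L) / n)) * n =
      n * (Lam (3 * k / n) θ ℓ + 3 * k / n * (Real.log u - Real.log ℓ))
      - 2 * (1 + Real.log (n + 1)) + n * ((u / 2 - 3 / 2 * x) / (1 + x)) - Real.log 2
      - L * Real.log (n + L) := by
    field_simp
  rw [e1]
  push_cast at h hlog t2
  linarith

theorem tendsto_log_add_div (c : ℝ) :
    Tendsto (fun n : ℕ => Real.log (n + c) / n) atTop (𝓝 0) := by
  have h1 : Tendsto (fun n : ℕ => (n : ℝ) + c) atTop atTop :=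
    tendsto_atTop_add_const_right _ _ tendsto_natCast_atTop_atTop
  have h2 : Tendsto (fun n : ℕ => Real.log (n + c) / ((n : ℝ) + c)) atTop (𝓝 0) := by
    have := Real.isLittleO_log_id_atTop.tendsto_div_nhds_zero.comp h1
    simpa [Function.comp_def] using this
  have h3 : Tendsto (fun n : ℕ => 1 + c / (n : ℝ)) atTop (𝓝 (1 + 0)) :=
    tendsto_const_nhds.add (tendsto_const_div_atTop_nhds_zero_nat c)
  have h4 := h2.mul h3
  rw [zero_mul] at h4
  refine h4.congr' ?_
  filter_upwards [h1.eventually_gt_atTop 0, eventually_gt_atTop 0] with n hn hn0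
  have hn' : (0 : ℝ) < n := by exact_mod_cast hn0
  field_simp

/-- The free energy in the critical window: the edges outside of the triangles contribute `ℓ / 2`
and the families of disjoint triangles the maximum of `Λ(·, θ, ℓ)`. -/
theorem tendsto_log_partitionSum {a ℓ : ℝ} (h0 : 0 < a) (h1 : a < 1) (hℓ : 0 < ℓ) {u : ℕ → ℝ}
    (hu : Tendsto u atTop (𝓝 ℓ)) :
    Tendsto (fun n : ℕ => Real.log (partitionSum (Fin n) (u n / n)
      (vertexWeight (dualParam a ℓ) n)) / n) atTop (𝓝 (ℓ / 2 + maxVal a)) := by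
  set θ := dualParam a ℓ with hθ
  have hupos : ∀ᶠ n in atTop, 0 < u n := hu.eventually_const_lt hℓ
  have hlogu : Tendsto (fun n => Real.log (u n) - Real.log ℓ) atTop (𝓝 0) := by
    have := (hu.log hℓ.ne').sub_const (Real.log ℓ)
    rwa [sub_self] at this
  have hlogn : Tendsto (fun n : ℕ => Real.log n) atTop atTop :=
    Real.tendsto_log_atTop.comp tendsto_natCast_atTop_atTop
  have hr : Tendsto (fun n : ℕ => Real.exp (-(Real.log n / 3))) atTop (𝓝 0) :=
    Real.tendsto_exp_neg_atTop_nhds_zero.comp (hlogn.atTop_div_const (by norm_num))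
  have hinv : ∀ c : ℝ, Tendsto (fun n : ℕ => c / (n : ℝ)) atTop (𝓝 0) :=
    tendsto_const_div_atTop_nhds_zero_nat
  have hl1 := tendsto_log_add_div 1
  refine tendsto_of_tendsto_of_tendsto_of_le_of_le' (f := fun n : ℕ =>
    Real.log (partitionSum (Fin n) (u n / n) (vertexWeight θ n)) / n) (b := atTop)
    (g := fun n : ℕ => Lam (3 * (⌊a * n / 3⌋₊ : ℕ) / n) θ ℓ
      + 3 * (⌊a * n / 3⌋₊ : ℕ) / n * (Real.log (u n) - Real.log ℓ)
      - 2 * (1 + Real.log (n + 1)) / n + (u n / 2 - 3 / 2 * (u n / n)) / (1 + u n / n)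
      - Real.log 2 / n
      - (⌈2 * ((ℓ + 1) ^ 2 + (ℓ + 1) ^ 3)⌉₊ : ℕ) *
        (Real.log (n + (⌈2 * ((ℓ + 1) ^ 2 + (ℓ + 1) ^ 3)⌉₊ : ℕ)) / n))
    (h := fun n : ℕ => u n / 2 + (maxVal a + |Real.log (u n) - Real.log ℓ|
      + (2 + 3 * Real.log (n + 1)) / n)
      + u n ^ 3 * Real.exp θ ^ 2 * Real.exp (-(Real.log n / 3)) / 2
      + 2 * (u n ^ 2 * Real.exp θ * Real.exp (-(Real.log n / 3)) ^ 2)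
      + u n / 2 * (Real.exp (u n ^ 2 * Real.exp θ * Real.exp (-(Real.log n / 3)) ^ 2) - 1))
    ?_ ?_ ?_ ?_
  -- lower bound with `3 k / n → a`, and with a constant number `L` of further triangles allowed
  · have hk : Tendsto (fun n : ℕ => 3 * ((⌊a * n / 3⌋₊ : ℕ) : ℝ) / n) atTop (𝓝 a) := by
      have h := (tendsto_nat_floor_mul_div_atTop (R := ℝ) (a := a / 3) (by positivity)).comp
        tendsto_natCast_atTop_atTop
      have h2 := h.const_mul 3
      rw [show 3 * (a / 3) = a by ring] at h2
      refine h2.congr fun n => ?_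
      simp only [Function.comp_apply]
      rw [show a / 3 * (n : ℝ) = a * n / 3 by ring]
      ring
    have hΛ : Tendsto (fun n : ℕ => Lam (3 * (⌊a * n / 3⌋₊ : ℕ) / n) θ ℓ) atTop
        (𝓝 (maxVal a)) := by
      rw [← Lam_dualParam_self h0 ℓ]
      exact (continuousAt_Lam h0 h1 θ ℓ).tendsto.comp hk
    have hun : Tendsto (fun n : ℕ => u n / n) atTop (𝓝 0) :=
      hu.div_atTop tendsto_natCast_atTop_atTop
    have hlog2 : Tendsto (fun n : ℕ => 2 * (1 + Real.log ((n : ℝ) + 1)) / n) atTop (𝓝 0) := by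
      have h := (hinv 2).add (hl1.const_mul 2)
      rw [mul_zero, add_zero] at h
      exact h.congr fun n => by ring
    have hE : Tendsto (fun n : ℕ => (u n / 2 - 3 / 2 * (u n / n)) / (1 + u n / n)) atTop
        (𝓝 (ℓ / 2)) := by
      have h := ((hu.div_const 2).sub (hun.const_mul (3 / 2))).div (hun.const_add 1) (by norm_num)
      rw [show (ℓ / 2 - 3 / 2 * 0) / (1 + 0) = ℓ / 2 by ring] at h
      exact h
    have h := ((((hΛ.add (hk.mul hlogu)).sub hlog2).add hE).sub (hinv (Real.log 2))).sub
      ((tendsto_log_add_div (⌈2 * ((ℓ + 1) ^ 2 + (ℓ + 1) ^ 3)⌉₊ : ℕ)).const_mul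
        ((⌈2 * ((ℓ + 1) ^ 2 + (ℓ + 1) ^ 3)⌉₊ : ℕ) : ℝ))
    rw [show maxVal a + a * 0 - 0 + ℓ / 2 - 0 -
      ((⌈2 * ((ℓ + 1) ^ 2 + (ℓ + 1) ^ 3)⌉₊ : ℕ) : ℝ) * 0 = ℓ / 2 + maxVal a by ring] at h
    exact h
  · have hlog3 : Tendsto (fun n : ℕ => (2 + 3 * Real.log ((n : ℝ) + 1)) / n) atTop (𝓝 0) := by
      have h := (hinv 2).add (hl1.const_mul 3)
      rw [mul_zero, add_zero] at h
      exact h.congr fun n => by ring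
    have hB := ((hu.pow 2).mul_const (Real.exp θ)).mul (hr.pow 2)
    rw [show ℓ ^ 2 * Real.exp θ * 0 ^ 2 = 0 by ring] at hB
    have hexp := (Real.continuous_exp.tendsto 0).comp hB
    rw [Real.exp_zero] at hexp
    have h := ((((hu.div_const 2).add ((hlogu.abs.const_add (maxVal a)).add hlog3)).add
      ((((hu.pow 3).mul_const (Real.exp θ ^ 2)).mul hr).div_const 2)).add (hB.const_mul 2)).add
      ((hu.div_const 2).mul (hexp.sub_const 1))
    rw [show ℓ / 2 + (maxVal a + |(0 : ℝ)| + 0) + ℓ ^ 3 * Real.exp θ ^ 2 * 0 / 2 + 2 * 0 +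
      ℓ / 2 * (1 - 1) = ℓ / 2 + maxVal a by simp] at h
    exact h
  · filter_upwards [hupos, eventually_ge_atTop 3, hlogn.eventually_ge_atTop (-3 * θ),
      hu.eventually_lt_const (show ℓ < ℓ + 1 by linarith)] with n hun hn hlog hlt
    refine le_log_partitionSum hun hn ?_ (by linarith) ?_
    · have h := Nat.floor_le (show 0 ≤ a * n / 3 by positivity)
      have h3 : ((3 * ⌊a * n / 3⌋₊ : ℕ) : ℝ) ≤ n := by
        push_cast
        nlinarith [show (0 : ℝ) ≤ n by positivity]
      exact_mod_cast h3
    · have h := Nat.le_ceil (2 * ((ℓ + 1) ^ 2 + (ℓ + 1) ^ 3))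
      have : u n ^ 2 + u n ^ 3 ≤ (ℓ + 1) ^ 2 + (ℓ + 1) ^ 3 := by gcongr
      linarith
  · filter_upwards [hupos, eventually_gt_atTop 0] with n hun hn
    exact log_partitionSum_le h0 h1 hun hn

/-! ### The exponential random graph measure as a ratio of partition functions -/

section Encoding

variable {n : ℕ}

open Classical in
/-- The edges of `G`, as `2`-element sets. -/
noncomputable def edgeFamily (G : SimpleGraph (Fin n)) : Finset (Finset (Fin n)) :=
  {e ∈ pairs (Fin n) | ∃ u v, G.Adj u v ∧ e = {u, v}}

theorem mem_edgeFamily {G : SimpleGraph (Fin n)} {e : Finset (Fin n)} :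
    e ∈ edgeFamily G ↔ e.card = 2 ∧ ∃ u v, G.Adj u v ∧ e = {u, v} := by
  simp [edgeFamily]

theorem edgeFamily_subset_pairs (G : SimpleGraph (Fin n)) : edgeFamily G ⊆ pairs (Fin n) :=
  fun _ he => mem_pairs.2 (mem_edgeFamily.1 he).1

theorem pair_mem_edgeFamily {G : SimpleGraph (Fin n)} {u v : Fin n} (huv : u ≠ v) :
    ({u, v} : Finset (Fin n)) ∈ edgeFamily G ↔ G.Adj u v := by
  rw [mem_edgeFamily]
  constructor
  · rintro ⟨-, u', v', hadj, heq⟩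
    have hu : u ∈ ({u', v'} : Finset (Fin n)) := by rw [← heq]; simp
    have hv : v ∈ ({u', v'} : Finset (Fin n)) := by rw [← heq]; simp
    simp only [Finset.mem_insert, Finset.mem_singleton] at hu hv
    rcases hu with rfl | rfl <;> rcases hv with rfl | rfl
    · exact absurd rfl huv
    · exact hadj
    · exact hadj.symm
    · exact absurd rfl huv
  · exact fun h => ⟨Finset.card_pair huv, u, v, h, rfl⟩

theorem card_edgeFamily (G : SimpleGraph (Fin n)) : (edgeFamily G).card = numEdges G := by
  have himg : (edgeFamily G : Set (Finset (Fin n))) = Sym2.toFinset '' G.edgeSet := by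
    ext e
    simp only [Finset.mem_coe, mem_edgeFamily, Set.mem_image]
    constructor
    · rintro ⟨-, u, v, hadj, rfl⟩
      exact ⟨s(u, v), hadj, by ext; simp⟩
    · rintro ⟨z, hz, rfl⟩
      induction z with
      | h u v =>
        have hadj : G.Adj u v := hz
        have : (s(u, v)).toFinset = {u, v} := by ext; simp
        rw [this]
        exact ⟨Finset.card_pair hadj.ne, u, v, hadj, rfl⟩
  rw [numEdges, ← Set.ncard_coe_finset, himg, Set.InjOn.ncard_image]
  intro z _ z' _ h
  ext y
  rw [← Sym2.mem_toFinset, h, Sym2.mem_toFinset]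

theorem card_triangleVerts_edgeFamily (G : SimpleGraph (Fin n)) :
    (triangleVerts (edgeFamily G)).card = numTriangleVertices G := by
  rw [numTriangleVertices, ← Set.ncard_coe_finset]
  congr 1
  ext v
  simp only [triangleVerts, Finset.coe_biUnion, Set.mem_iUnion, Finset.mem_coe, id,
    Set.mem_ofPred_eq, mem_triangles, exists_prop]
  constructor
  · rintro ⟨t, ⟨ht3, htG⟩, hv⟩
    obtain ⟨u, w, huw, htuw⟩ := Finset.card_eq_two.1
      (show (t.erase v).card = 2 by rw [Finset.card_erase_of_mem hv, ht3])
    have hu : u ∈ t.erase v := by rw [htuw]; simp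
    have hw : w ∈ t.erase v := by rw [htuw]; simp
    rw [Finset.mem_erase] at hu hw
    have hadj : ∀ a b, a ∈ t → b ∈ t → a ≠ b → G.Adj a b := fun a b ha hb hab =>
      (pair_mem_edgeFamily hab).1 (htG (Finset.mem_powersetCard.2
        ⟨Finset.insert_subset ha (Finset.singleton_subset_iff.2 hb), Finset.card_pair hab⟩))
    exact ⟨u, w, hadj v u hv hu.2 hu.1.symm, hadj u w hu.2 hw.2 huw, hadj w v hw.2 hv hw.1⟩
  · rintro ⟨u, w, hvu, huw, hwv⟩
    refine ⟨{v, u, w}, ⟨Finset.card_eq_three.2 ⟨v, u, w, hvu.ne, hwv.ne', huw.ne, rfl⟩, ?_⟩,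
      by simp⟩
    intro e he
    obtain ⟨het, hec⟩ := Finset.mem_powersetCard.1 he
    obtain ⟨a, b, hab, rfl⟩ := Finset.card_eq_two.1 hec
    rw [pair_mem_edgeFamily hab]
    have ha : a ∈ ({v, u, w} : Finset (Fin n)) := het (by simp)
    have hb : b ∈ ({v, u, w} : Finset (Fin n)) := het (by simp)
    simp only [Finset.mem_insert, Finset.mem_singleton] at ha hb
    rcases ha with rfl | rfl | rfl <;> rcases hb with rfl | rfl | rfl <;>
      first | exact absurd rfl hab | assumption | (apply SimpleGraph.Adj.symm; assumption)

theorem sum_simpleGraph_eq_partitionSum (x w : ℝ) :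
    ∑ G : SimpleGraph (Fin n), x ^ numEdges G * w ^ numTriangleVertices G =
      partitionSum (Fin n) x w := by
  classical
  rw [partitionSum]
  refine Finset.sum_bij (fun G _ => edgeFamily G) ?_ ?_ ?_ ?_
  · exact fun G _ => Finset.mem_powerset.2 (edgeFamily_subset_pairs G)
  · intro G _ G' _ h
    ext u v
    by_cases huv : u = v
    · subst huv; simp
    · rw [← pair_mem_edgeFamily huv, h, pair_mem_edgeFamily huv]
  · intro A hA
    have hadj : ∀ u v, (SimpleGraph.fromRel fun u v => ({u, v} : Finset (Fin n)) ∈ A).Adj u v ↔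
        u ≠ v ∧ ({u, v} : Finset (Fin n)) ∈ A := by
      intro u v
      rw [SimpleGraph.fromRel_adj, Finset.pair_comm v u, or_self]
    refine ⟨SimpleGraph.fromRel fun u v => {u, v} ∈ A, Finset.mem_univ _, ?_⟩
    ext e
    constructor
    · intro he
      obtain ⟨u, v, huv, rfl⟩ := (mem_edgeFamily.1 he).2
      exact ((hadj u v).1 huv).2
    · intro he
      obtain ⟨u, v, huv, rfl⟩ := Finset.card_eq_two.1 (mem_pairs.1 (Finset.mem_powerset.1 hA he))
      exact (pair_mem_edgeFamily huv).2 ((hadj u v).2 ⟨huv, he⟩)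
  · intro G _
    rw [card_edgeFamily, card_triangleVerts_edgeFamily]

end Encoding

/-- `n` times the edge odds `p / (1 - p)`, for `p = lam / n`. -/
noncomputable def scaledOdds (lam : ℝ) (n : ℕ) : ℝ :=
  lam / (1 - lam / n)

theorem tendsto_scaledOdds (lam : ℝ) : Tendsto (scaledOdds lam) atTop (𝓝 lam) := by
  have h := (tendsto_const_nhds (x := lam)).div
    ((tendsto_const_div_atTop_nhds_zero_nat lam).const_sub 1) (by norm_num)
  rw [sub_zero, div_one] at h
  exact h

theorem erdosRenyi_real_singleton {lam : ℝ} (hlam : 0 < lam) {n : ℕ} (hn : lam < n)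
    (G : SimpleGraph (Fin n)) :
    (erdosRenyi lam n).real {G} =
      (1 - lam / n) ^ (pairs (Fin n)).card * (scaledOdds lam n / n) ^ numEdges G := by
  have hn' : (0 : ℝ) < n := hlam.trans hn
  have hp0 : 0 ≤ lam / n := by positivity
  have hp1 : lam / n < 1 := (div_lt_one hn').2 hn
  have hq : 0 < 1 - lam / n := by linarith
  have hval : ((edgeProb lam n : unitInterval) : ℝ) = lam / n := by
    rw [edgeProb, Set.projIcc_of_mem zero_le_one ⟨hp0, hp1.le⟩]
  have hle : numEdges G ≤ (pairs (Fin n)).card := by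
    rw [← card_edgeFamily]
    exact Finset.card_le_card (edgeFamily_subset_pairs G)
  have hodds : scaledOdds lam n / n = lam / n / (1 - lam / n) := by
    rw [scaledOdds]; ring
  have hN : (pairs (Fin n)).card = (Nat.card (Fin n)).choose 2 := by
    rw [pairs, Finset.card_powersetCard, Finset.card_univ, Nat.card_eq_fintype_card]
  rw [measureReal_def, erdosRenyi, SimpleGraph.binomialRandom_singleton, ← hN,
    show G.edgeSet.ncard = numEdges G from rfl, ENNReal.toReal_mul, ENNReal.toReal_pow,
    ENNReal.toReal_pow, ENNReal.coe_toReal, ENNReal.coe_toReal, unitInterval.coe_toNNReal,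
    unitInterval.coe_toNNReal, unitInterval.coe_symm_eq, hval, hodds,
    ← pow_sub_mul_pow (1 - lam / n) hle]
  generalize 1 - lam / n = q at hq
  generalize lam / n = p
  rw [div_pow]
  field_simp

open Classical in
theorem criticalErgm_apply {lam : ℝ} (hlam : 0 < lam) (θ : ℝ) {n : ℕ} (hn : lam < n) (hn2 : 2 ≤ n)
    (S : Set (SimpleGraph (Fin n))) :
    criticalErgm lam θ n S = ENNReal.ofReal
      ((∑ G, if G ∈ S then (scaledOdds lam n / n) ^ numEdges G *
        vertexWeight θ n ^ numTriangleVertices G else 0) /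
        partitionSum (Fin n) (scaledOdds lam n / n) (vertexWeight θ n)) := by
  have hn1 : (1 : ℝ) < n := by exact_mod_cast hn2
  have hlog : Real.log n ≠ 0 := (Real.log_pos hn1).ne'
  have hq : 0 < 1 - lam / n := by
    have := (div_lt_one (hlam.trans hn)).2 hn
    linarith
  have hprob : IsProbabilityMeasure (erdosRenyi lam n) := by unfold erdosRenyi; infer_instance
  have hexp : ∀ G : SimpleGraph (Fin n),
      Real.exp ((1 / 3 + θ / Real.log n) * Real.log n * numTriangleVertices G) =
        vertexWeight θ n ^ numTriangleVertices G := by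
    intro G
    rw [vertexWeight, ← Real.exp_nat_mul]
    congr 1
    field_simp
    ring
  have hZ : ∫ G, Real.exp ((1 / 3 + θ / Real.log n) * Real.log n * numTriangleVertices G)
      ∂(erdosRenyi lam n) = (1 - lam / n) ^ (pairs (Fin n)).card *
        partitionSum (Fin n) (scaledOdds lam n / n) (vertexWeight θ n) := by
    rw [integral_fintype Integrable.of_finite, ← sum_simpleGraph_eq_partitionSum, Finset.mul_sum]
    refine Finset.sum_congr rfl fun G _ => ?_
    rw [erdosRenyi_real_singleton hlam hn, hexp, smul_eq_mul, mul_assoc]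
  rw [criticalErgm, ergm, tilted_apply_eq_ofReal_integral, hZ]
  congr 1
  rw [← integral_indicator S.toFinite.measurableSet, integral_fintype Integrable.of_finite,
    Finset.sum_div]
  refine Finset.sum_congr rfl fun G _ => ?_
  rw [erdosRenyi_real_singleton hlam hn, smul_eq_mul, Set.indicator_apply]
  have hpow : (1 - lam / n) ^ (pairs (Fin n)).card ≠ 0 := (pow_pos hq _).ne'
  split_ifs
  · rw [hexp, mul_assoc, mul_div_assoc', mul_div_assoc', mul_div_mul_left _ _ hpow]
  · simp

/-! ### Exponential Markov inequality and concentration -/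

theorem criticalErgm_le {lam : ℝ} (hlam : 0 < lam) (θ s τ c : ℝ) {n : ℕ} (hn : lam < n)
    (hn2 : 2 ≤ n) :
    criticalErgm lam θ n {G | c * n ≤ s * numEdges G + τ * numTriangleVertices G} ≤
      ENNReal.ofReal (Real.exp (n * (-c
        + Real.log (partitionSum (Fin n) (scaledOdds lam n * Real.exp s / n)
          (vertexWeight (θ + τ) n)) / n
        - Real.log (partitionSum (Fin n) (scaledOdds lam n / n) (vertexWeight θ n)) / n))) := by
  classical
  have hn' : (0 : ℝ) < n := hlam.trans hn
  have hq : 0 < 1 - lam / n := by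
    have := (div_lt_one hn').2 hn
    linarith
  have hx : 0 < scaledOdds lam n := div_pos hlam hq
  have hw : ∀ θ, 0 < vertexWeight θ n := fun _ => Real.exp_pos _
  have hY := partitionSum_pos (V := Fin n) (div_pos hx hn').le (hw θ)
  have hY' := partitionSum_pos (V := Fin n)
    (show 0 ≤ scaledOdds lam n * Real.exp s / n by positivity) (hw (θ + τ))
  have hw' : vertexWeight (θ + τ) n = vertexWeight θ n * Real.exp τ := by
    rw [vertexWeight, vertexWeight, ← Real.exp_add]; ring_nf
  have hexp : Real.exp (n * (-c
      + Real.log (partitionSum (Fin n) (scaledOdds lam n * Real.exp s / n)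
        (vertexWeight (θ + τ) n)) / n
      - Real.log (partitionSum (Fin n) (scaledOdds lam n / n) (vertexWeight θ n)) / n)) =
      Real.exp (-(c * n)) * partitionSum (Fin n) (scaledOdds lam n * Real.exp s / n)
        (vertexWeight (θ + τ) n) /
        partitionSum (Fin n) (scaledOdds lam n / n) (vertexWeight θ n) := by
    rw [← Real.exp_log hY, ← Real.exp_log hY', Real.log_exp, Real.log_exp, ← Real.exp_add,
      ← Real.exp_sub]
    congr 1
    field_simp
  rw [criticalErgm_apply hlam θ hn hn2, hexp]
  refine ENNReal.ofReal_le_ofReal (div_le_div_of_nonneg_right ?_ hY.le)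
  rw [← sum_simpleGraph_eq_partitionSum (scaledOdds lam n * Real.exp s / n), Finset.mul_sum]
  refine Finset.sum_le_sum fun G _ => ?_
  have h0 : 0 ≤ (scaledOdds lam n / n) ^ numEdges G * vertexWeight θ n ^ numTriangleVertices G :=
    mul_nonneg (by positivity) (pow_nonneg (hw θ).le _)
  have heq : Real.exp (-(c * n)) * ((scaledOdds lam n * Real.exp s / n) ^ numEdges G *
      vertexWeight (θ + τ) n ^ numTriangleVertices G) =
      Real.exp (s * numEdges G + τ * numTriangleVertices G - c * n) *
      ((scaledOdds lam n / n) ^ numEdges G * vertexWeight θ n ^ numTriangleVertices G) := by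
    rw [hw', show scaledOdds lam n * Real.exp s / n = scaledOdds lam n / n * Real.exp s by ring,
      mul_pow, mul_pow, ← Real.exp_nat_mul, ← Real.exp_nat_mul, sub_eq_add_neg, Real.exp_add,
      Real.exp_add, mul_comm s, mul_comm τ]
    ring
  rw [heq]
  split_ifs with hG
  · have hG' : c * n ≤ s * numEdges G + τ * numTriangleVertices G := hG
    exact le_mul_of_one_le_left h0 (Real.one_le_exp (by linarith))
  · exact mul_nonneg (Real.exp_pos _).le h0

/-- A linear combination of the numbers of edges and triangle vertices is improbable to exceed
`c n` when `c` is above the increment of the free energy under the corresponding tilt. -/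
theorem tendsto_criticalErgm_zero {lam a b s τ c : ℝ} (hlam : 0 < lam) (ha0 : 0 < a) (ha1 : a < 1)
    (hb0 : 0 < b) (hb1 : b < 1)
    (hτ : dualParam b (lam * Real.exp s) = dualParam a lam + τ)
    (hc : lam * Real.exp s / 2 + maxVal b - (lam / 2 + maxVal a) < c) :
    Tendsto (fun n : ℕ => criticalErgm lam (dualParam a lam) n
      {G | c * n ≤ s * numEdges G + τ * numTriangleVertices G}) atTop (𝓝 0) := by
  have h1 := tendsto_log_partitionSum ha0 ha1 hlam (tendsto_scaledOdds lam)
  have h2 := tendsto_log_partitionSum hb0 hb1 (mul_pos hlam (Real.exp_pos s))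
    ((tendsto_scaledOdds lam).mul_const (Real.exp s))
  rw [hτ] at h2
  have h3 := (h2.const_add (-c)).sub h1
  have h4 := tendsto_natCast_atTop_atTop.atTop_mul_neg (by linarith) h3
  have h5 := ENNReal.tendsto_ofReal (Real.tendsto_exp_atBot.comp h4)
  rw [ENNReal.ofReal_zero] at h5
  refine tendsto_of_tendsto_of_tendsto_of_le_of_le' tendsto_const_nhds h5
    (Eventually.of_forall fun _ => zero_le) ?_
  filter_upwards [eventually_ge_atTop 2,
    tendsto_natCast_atTop_atTop.eventually_gt_atTop lam] with n hn2 hn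
  exact criticalErgm_le hlam _ s τ c hn hn2

theorem tendstoInProb_of_two_sided {P : ∀ n : ℕ, Measure (SimpleGraph (Fin n))}
    {X : ∀ n : ℕ, SimpleGraph (Fin n) → ℝ} {c : ℝ}
    (hu : ∀ ε : ℝ, 0 < ε → Tendsto (fun n => P n {G | c + ε ≤ X n G}) atTop (𝓝 0))
    (hl : ∀ ε : ℝ, 0 < ε → Tendsto (fun n => P n {G | X n G ≤ c - ε}) atTop (𝓝 0)) :
    TendstoInProb P X c := by
  intro ε hε
  have h := (hu ε hε).add (hl ε hε)
  rw [add_zero] at h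
  refine tendsto_of_tendsto_of_tendsto_of_le_of_le tendsto_const_nhds h (fun _ => zero_le)
    fun n => (measure_mono ?_).trans (measure_union_le _ _)
  intro G hG
  rcases le_abs.1 (show ε ≤ |X n G - c| from hG) with h | h
  · exact Or.inl (show c + ε ≤ X n G by linarith)
  · exact Or.inr (show X n G ≤ c - ε by linarith)

theorem tendsto_measure_zero_of_subset {P : ∀ n : ℕ, Measure (SimpleGraph (Fin n))}
    {S T : ∀ n : ℕ, Set (SimpleGraph (Fin n))}
    (hT : Tendsto (fun n => P n (T n)) atTop (𝓝 0)) (h : ∀ n : ℕ, 0 < n → S n ⊆ T n) :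
    Tendsto (fun n => P n (S n)) atTop (𝓝 0) := by
  refine tendsto_of_tendsto_of_tendsto_of_le_of_le' tendsto_const_nhds hT
    (Eventually.of_forall fun _ => zero_le) ?_
  filter_upwards [eventually_gt_atTop 0] with n hn
  exact measure_mono (h n hn)

/-- Convexity of the maximum of `Λ(·, θ, ℓ)` in `θ`. -/
theorem maxVal_sub_le {a b : ℝ} (ha0 : 0 < a) (ha1 : a < 1) (hb0 : 0 < b) (hb1 : b < 1) (ℓ : ℝ) :
    maxVal b - maxVal a ≤ (dualParam b ℓ - dualParam a ℓ) * b := by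
  have h1 := Lam_le_maxVal ha0 ha1 (a := b) ⟨hb0.le, hb1.le⟩ ℓ
  have h2 := Lam_add b (dualParam a ℓ) (dualParam b ℓ - dualParam a ℓ) ℓ
  rw [add_sub_cancel, Lam_dualParam_self hb0] at h2
  linarith

/-- The density of triangle vertices concentrates at the maximizer of `Λ`. -/
theorem tendstoInProb_triangleDensity {lam a : ℝ} (hlam : 0 < lam) (ha0 : 0 < a) (ha1 : a < 1) :
    TendstoInProb (criticalErgm lam (dualParam a lam))
      (fun n G => (numTriangleVertices G : ℝ) / n) a := by
  refine tendstoInProb_of_two_sided (fun ε hε => ?_) (fun ε hε => ?_)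
  -- tilting `θ` moves the maximizer to a point `b` strictly between `a` and `a ± ε`
  · obtain ⟨b, hab, hb⟩ := exists_between (lt_min ha1 (show a < a + ε by linarith))
    obtain ⟨hb1, hbε⟩ := lt_min_iff.1 hb
    have hb0 := ha0.trans hab
    have hτ := sub_pos.2 (dualParam_lt_dualParam ha0 hab hb1 lam)
    have hconv := maxVal_sub_le ha0 ha1 hb0 hb1 lam
    refine tendsto_measure_zero_of_subset (tendsto_criticalErgm_zero (s := 0)
      (τ := dualParam b lam - dualParam a lam) (c := (dualParam b lam - dualParam a lam) * (a + ε))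
      hlam ha0 ha1 hb0 hb1 (by simp) ?_) fun n hn G hG => ?_
    · have := mul_lt_mul_of_pos_left hbε hτ
      rw [Real.exp_zero]
      linarith
    · have hn' : (0 : ℝ) < n := by exact_mod_cast hn
      have hG' := (le_div_iff₀ hn').1 (show a + ε ≤ (numTriangleVertices G : ℝ) / n from hG)
      have := mul_le_mul_of_nonneg_left hG' hτ.le
      simp only [Set.mem_ofPred_eq]
      linarith
  · obtain ⟨b, hb, hba⟩ := exists_between (max_lt ha0 (show a - ε < a by linarith))
    obtain ⟨hb0, hbε⟩ := max_lt_iff.1 hb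
    have hb1 := hba.trans ha1
    have hτ := sub_neg.2 (dualParam_lt_dualParam hb0 hba ha1 lam)
    have hconv := maxVal_sub_le ha0 ha1 hb0 hb1 lam
    refine tendsto_measure_zero_of_subset (tendsto_criticalErgm_zero (s := 0)
      (τ := dualParam b lam - dualParam a lam) (c := (dualParam b lam - dualParam a lam) * (a - ε))
      hlam ha0 ha1 hb0 hb1 (by simp) ?_) fun n hn G hG => ?_
    · have := mul_lt_mul_of_neg_left hbε hτ
      rw [Real.exp_zero]
      linarith
    · have hn' : (0 : ℝ) < n := by exact_mod_cast hn
      have hG' := (div_le_iff₀ hn').1 (show (numTriangleVertices G : ℝ) / n ≤ a - ε from hG)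
      have := mul_le_mul_of_nonpos_left hG' hτ.le
      simp only [Set.mem_ofPred_eq]
      linarith

/-- Tilting by `e^(s (E - V_T))` changes `λ` to `λ e^s` and `θ` to `θ - s`, hence leaves the
maximizer of `Λ` fixed; only the edges outside of the triangles see the tilt. -/
theorem tendsto_criticalErgm_excess_zero {lam a s c : ℝ} (hlam : 0 < lam) (ha0 : 0 < a)
    (ha1 : a < 1) (hc : lam * (Real.exp s - 1) / 2 < c) :
    Tendsto (fun n : ℕ => criticalErgm lam (dualParam a lam) n
      {G | c * n ≤ s * numEdges G + -s * numTriangleVertices G}) atTop (𝓝 0) := by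
  refine tendsto_criticalErgm_zero hlam ha0 ha1 ha0 ha1 ?_ (by linarith)
  rw [dualParam, dualParam, Real.log_mul hlam.ne' (Real.exp_pos s).ne', Real.log_exp]
  ring

/-- `λ̂_n` is consistent. -/
theorem tendstoInProb_lamHat {lam a : ℝ} (hlam : 0 < lam) (ha0 : 0 < a) (ha1 : a < 1) :
    TendstoInProb (criticalErgm lam (dualParam a lam)) (fun _ G => lamHat G) lam := by
  -- a small tilt `s`, for which `e^s - 1 - s ≤ s ^ 2` is negligible against `s ε`
  have hexp : ∀ ε s : ℝ, |s| ≤ 1 → lam * |s| ≤ ε / 2 → s ≠ 0 → 0 < ε →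
      lam * (Real.exp s - 1) / 2 < s * (lam / 2) + |s| * (ε / 2) := by
    intro ε s hs1 hs2 hs0 hε
    have h1 := (abs_le.1 (Real.abs_exp_sub_one_sub_id_le hs1)).2
    have h2 : lam * s ^ 2 ≤ ε / 2 * |s| := by
      rw [← sq_abs, sq, ← mul_assoc]
      exact mul_le_mul_of_nonneg_right hs2 (abs_nonneg s)
    have h3 := mul_le_mul_of_nonneg_left h1 hlam.le
    have h4 := mul_pos (abs_pos.2 hs0) hε
    linarith
  refine tendstoInProb_of_two_sided (fun ε hε => ?_) (fun ε hε => ?_)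
  all_goals
    have hs : 0 < min 1 (ε / (2 * lam)) := lt_min one_pos (by positivity)
    obtain ⟨s, hsdef⟩ : ∃ s, s = min 1 (ε / (2 * lam)) := ⟨_, rfl⟩
    rw [← hsdef] at hs
    have hs1 : s ≤ 1 := hsdef ▸ min_le_left _ _
    have hs2 : lam * s ≤ ε / 2 := by
      have : s ≤ ε / (2 * lam) := hsdef ▸ min_le_right _ _
      rw [le_div_iff₀ (by positivity)] at this
      linarith
  · have h := hexp ε s (by rwa [abs_of_pos hs]) (by rwa [abs_of_pos hs]) hs.ne' hε
    refine tendsto_measure_zero_of_subset (tendsto_criticalErgm_excess_zero hlam ha0 ha1 h)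
      fun n hn G hG => ?_
    have hn' : (0 : ℝ) < n := by exact_mod_cast hn
    have hG' : lam + ε ≤ 2 * (numEdges G : ℝ) / n - 2 * (numTriangleVertices G : ℝ) / n := hG
    rw [← sub_div, le_div_iff₀ hn'] at hG'
    have := mul_le_mul_of_nonneg_left hG' hs.le
    simp only [Set.mem_ofPred_eq, abs_of_pos hs]
    linarith
  · have h := hexp ε (-s) (by rwa [abs_neg, abs_of_pos hs]) (by rwa [abs_neg, abs_of_pos hs])
      (neg_ne_zero.2 hs.ne') hε
    refine tendsto_measure_zero_of_subset (tendsto_criticalErgm_excess_zero hlam ha0 ha1 h)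
      fun n hn G hG => ?_
    have hn' : (0 : ℝ) < n := by exact_mod_cast hn
    have hG' : 2 * (numEdges G : ℝ) / n - 2 * (numTriangleVertices G : ℝ) / n ≤ lam - ε := hG
    rw [← sub_div, div_le_iff₀ hn'] at hG'
    have := mul_le_mul_of_nonneg_left hG' hs.le
    simp only [Set.mem_ofPred_eq, abs_neg, abs_of_pos hs]
    linarith

theorem thetaHatSet_eq_singleton {n : ℕ} {G : SimpleGraph (Fin n)} (hℓ : 0 < lamHat G)
    (h0 : 0 < (numTriangleVertices G : ℝ) / n) (h1 : (numTriangleVertices G : ℝ) / n < 1) :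
    thetaHatSet G = {dualParam ((numTriangleVertices G : ℝ) / n) (lamHat G)} := by
  ext x
  simp only [thetaHatSet, Set.mem_ofPred_eq, argmaxLam_eq_singleton_iff hℓ, hℓ, h0, h1, true_and,
    Set.mem_singleton_iff]

/-- With probability tending to one, `Θ̂_n` consists of a single point, which is close to `θ`. -/
theorem tendsto_criticalErgm_not_near {lam a ε : ℝ} (hlam : 0 < lam) (ha0 : 0 < a) (ha1 : a < 1)
    (hε : 0 < ε) :
    Tendsto (fun n : ℕ => criticalErgm lam (dualParam a lam) n
      {G | ¬ ∃ x, thetaHatSet G = {x} ∧ |x - dualParam a lam| < ε}) atTop (𝓝 0) := by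
  have hcont := (continuousAt_dualParam ha0 ha1 hlam).tendsto.eventually
    (Metric.ball_mem_nhds _ hε)
  have hev : ∀ᶠ q : ℝ × ℝ in 𝓝 (a, lam), 0 < q.1 ∧ q.1 < 1 ∧ 0 < q.2 := by
    refine (continuous_fst.tendsto (a, lam)).eventually (lt_mem_nhds ha0) |>.and ?_
    refine (continuous_fst.tendsto (a, lam)).eventually (gt_mem_nhds ha1) |>.and ?_
    exact (continuous_snd.tendsto (a, lam)).eventually (lt_mem_nhds hlam)
  obtain ⟨δ, hδ, hball⟩ := Metric.eventually_nhds_iff.1 (hcont.and hev)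
  have h := (tendstoInProb_triangleDensity hlam ha0 ha1 δ hδ).add
    (tendstoInProb_lamHat hlam ha0 ha1 δ hδ)
  rw [add_zero] at h
  refine tendsto_of_tendsto_of_tendsto_of_le_of_le tendsto_const_nhds h (fun _ => zero_le)
    fun n => (measure_mono ?_).trans (measure_union_le _ _)
  intro G hG
  by_contra hnot
  simp only [Set.mem_union, Set.mem_ofPred_eq, not_or, not_le] at hnot
  obtain ⟨hnear, h0, h1, hℓ⟩ :=
    hball (y := ((numTriangleVertices G : ℝ) / n, lamHat G)) (by
      rw [Prod.dist_eq, max_lt_iff, Real.dist_eq, Real.dist_eq]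
      exact hnot)
  exact hG ⟨_, thetaHatSet_eq_singleton hℓ h0 h1, by simpa [Real.dist_eq] using hnear⟩

end TriangleERGM

theorem theorem4p1 (lam θ : ℝ) (hlam : 0 < lam) :
    -- `λ̂_n` converges to `λ` in probability
    TriangleERGM.TendstoInProb (TriangleERGM.criticalErgm lam θ)
      (fun _ G => TriangleERGM.lamHat G) lam ∧
    -- `θ̂_n` is well defined with probability tending to one
    Tendsto (fun n : ℕ => TriangleERGM.criticalErgm lam θ n
        {G : SimpleGraph (Fin n) | ∃! x : ℝ, x ∈ TriangleERGM.thetaHatSet G}) atTop (𝓝 1) ∧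
    -- and, however it is defined where its defining equation has no solution, it converges to `θ`
    -- in probability
    ∀ thetaHat : ∀ n : ℕ, SimpleGraph (Fin n) → ℝ,
      (∀ (n : ℕ) (G : SimpleGraph (Fin n)), (TriangleERGM.thetaHatSet G).Nonempty →
        thetaHat n G ∈ TriangleERGM.thetaHatSet G) →
      TriangleERGM.TendstoInProb (TriangleERGM.criticalErgm lam θ) thetaHat θ := by
  obtain ⟨a, ha0, ha1, rfl⟩ := TriangleERGM.exists_dualParam_eq θ hlam
  refine ⟨TriangleERGM.tendstoInProb_lamHat hlam ha0 ha1, ?_, fun thetaHat hth ε hε => ?_⟩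
  · have h := TriangleERGM.tendsto_criticalErgm_not_near hlam ha0 ha1 one_pos
    have h2 := ENNReal.Tendsto.sub (tendsto_const_nhds (x := (1 : ENNReal)) (f := atTop)) h
      (Or.inl ENNReal.one_ne_top)
    rw [tsub_zero] at h2
    refine tendsto_of_tendsto_of_tendsto_of_le_of_le h2 tendsto_const_nhds (fun n => ?_)
      (fun n => ?_)
    · have : IsProbabilityMeasure (TriangleERGM.criticalErgm lam
          (TriangleERGM.dualParam a lam) n) := TriangleERGM.isProbabilityMeasure_ergm _ _ _
      rw [← prob_compl_eq_one_sub (Set.toFinite _).measurableSet]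
      refine measure_mono fun G hG => ?_
      simp only [Set.mem_compl_iff, Set.mem_ofPred_eq, not_not] at hG
      obtain ⟨x, hx, -⟩ := hG
      exact ⟨x, by simp [hx], fun y hy => by simpa [hx] using hy⟩
    · have : IsProbabilityMeasure (TriangleERGM.criticalErgm lam
          (TriangleERGM.dualParam a lam) n) := TriangleERGM.isProbabilityMeasure_ergm _ _ _
      exact prob_le_one
  · refine TriangleERGM.tendsto_measure_zero_of_subset
      (TriangleERGM.tendsto_criticalErgm_not_near hlam ha0 ha1 hε) fun n _ G hG => ?_
    rintro ⟨x, hx, hlt⟩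
    have hmem := hth n G (by rw [hx]; exact Set.singleton_nonempty x)
    rw [hx, Set.mem_singleton_iff] at hmem
    rw [← hmem] at hlt
    exact absurd hlt (not_lt.2 hG)
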